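/- An instance of Equitable Coloring consists of a finite simple graph $G$ on $n$ vertices and an integer $k$; the question is whether $G$ has a proper coloring with $k$ colors in which every color is used at least $\lfloor n/k\rfloor$ and at most $\lceil n/k\rceil$ times. A cluster graph is a graph in which every connected component is a clique, and the distance to cluster $\mathrm{dc}(G)$ is the least size of a set $U\subseteq V(G)$ such that $G-U$ is a cluster graph. Theorem. Equitable Coloring parameterized by the distance to cluster is fixed-parameter tractable: there are a computable function $f$, a constant $c$ and an algorithm (a program of a random access machine with unit-cost addition and subtraction) that, given only $(G,k)$ as a binary word $x$ (the adjacency matrix of $G$ and $k$ in binary), decides whether $G$ has an equitable $k$-coloring in at most $f(\mathrm{dc}(G))\cdot(|x|+1)^{c}$ steps. Moreover, this holds with $f(d)=2^{O(d\log d)}$; more precisely, with $f(d)=a\cdot d^{\,a d}$ for some constant $a$ (where $0^0=1$). -/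

import Mathlib

/-! ### Random access machines with unit cost -/

namespace RAM

/-- The memory of a random access machine: one natural number in each of the registers
`0, 1, 2, …`. -/
abbrev Mem : Type := ℕ → ℕ

/-- Arithmetic expressions: literals, the contents of the register whose address is given by an
expression (direct and indirect addressing), addition and cut-off subtraction. There is no
multiplication, so that uniform cost is polynomially equivalent to Turing machine time. -/
inductive Expr : Type
  | const (n : ℕ) : Expr
  | read (addr : Expr) : Expr
  | add (a b : Expr) : Expr
  | sub (a b : Expr) : Expr

namespace Expr

/-- The value of an expression. -/
def eval (m : Mem) : Expr → ℕ
  | const n => n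
  | read a => m (a.eval m)
  | add a b => a.eval m + b.eval m
  | sub a b => a.eval m - b.eval m

/-- The number of elementary operations needed to evaluate an expression. -/
def cost : Expr → ℕ
  | const _ => 1
  | read a => a.cost + 1
  | add a b => a.cost + b.cost + 1
  | sub a b => a.cost + b.cost + 1

end Expr

/-- Programs of the random access machine, with structured control flow. A test succeeds when
the tested expression is nonzero. -/
inductive Prog : Type
  | skip : Prog
  | store (addr val : Expr) : Prog
  | seq (p q : Prog) : Prog
  | ite (e : Expr) (p q : Prog) : Prog
  | loop (e : Expr) (p : Prog) : Prog

/-- `Runs p m t m'`: started on the memory `m`, the program `p` halts after exactly `t` steps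
with the memory `m'`. Every elementary operation, every store and every test takes one step;
`loop e p` is the loop `while e ≠ 0 do p`. -/
inductive Runs : Prog → Mem → ℕ → Mem → Prop
  | skip (m : Mem) : Runs Prog.skip m 1 m
  | store (a e : Expr) (m : Mem) :
      Runs (Prog.store a e) m (a.cost + e.cost + 1) (Function.update m (a.eval m) (e.eval m))
  | seq {p q : Prog} {m m' m'' : Mem} {t t' : ℕ} :
      Runs p m t m' → Runs q m' t' m'' → Runs (Prog.seq p q) m (t + t') m''
  | ite_true {e : Expr} {p q : Prog} {m m' : Mem} {t : ℕ} :
      e.eval m ≠ 0 → Runs p m t m' → Runs (Prog.ite e p q) m (e.cost + 1 + t) m'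
  | ite_false {e : Expr} {p q : Prog} {m m' : Mem} {t : ℕ} :
      e.eval m = 0 → Runs q m t m' → Runs (Prog.ite e p q) m (e.cost + 1 + t) m'
  | loop_done {e : Expr} {p : Prog} {m : Mem} :
      e.eval m = 0 → Runs (Prog.loop e p) m (e.cost + 1) m
  | loop_step {e : Expr} {p : Prog} {m m' m'' : Mem} {t t' : ℕ} :
      e.eval m ≠ 0 → Runs p m t m' → Runs (Prog.loop e p) m' t' m'' →
        Runs (Prog.loop e p) m (e.cost + 1 + t + t') m''

/-- The machine is deterministic: a program has at most one halting computation on a memory. -/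
theorem Runs.unique {p : Prog} {m m₁ : Mem} {t₁ : ℕ} (h₁ : Runs p m t₁ m₁) :
    ∀ {m₂ : Mem} {t₂ : ℕ}, Runs p m t₂ m₂ → t₁ = t₂ ∧ m₁ = m₂ := by
  induction h₁ with
  | skip m => intro _ _ h; cases h; exact ⟨rfl, rfl⟩
  | store a e m => intro _ _ h; cases h; exact ⟨rfl, rfl⟩
  | seq _ _ ih ih' =>
    intro _ _ h
    cases h with
    | seq g g' =>
      obtain ⟨rfl, rfl⟩ := ih g
      obtain ⟨rfl, rfl⟩ := ih' g'
      exact ⟨rfl, rfl⟩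
  | ite_true he _ ih =>
    intro _ _ h
    cases h with
    | ite_true _ g => obtain ⟨rfl, rfl⟩ := ih g; exact ⟨rfl, rfl⟩
    | ite_false he' _ => exact absurd he' he
  | ite_false he _ ih =>
    intro _ _ h
    cases h with
    | ite_true he' _ => exact absurd he he'
    | ite_false _ g => obtain ⟨rfl, rfl⟩ := ih g; exact ⟨rfl, rfl⟩
  | loop_done he =>
    intro _ _ h
    cases h with
    | loop_done _ => exact ⟨rfl, rfl⟩
    | loop_step he' _ _ => exact absurd he he'
  | loop_step he _ _ ih ih' =>
    intro _ _ h
    cases h with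
    | loop_done he' => exact absurd he' he
    | loop_step _ g g' =>
      obtain ⟨rfl, rfl⟩ := ih g
      obtain ⟨rfl, rfl⟩ := ih' g'
      exact ⟨rfl, rfl⟩

/-- The initial memory on a binary input word: register `0` holds the length of the word,
register `i + 1` its letter number `i` (counted from `0`), all other registers hold `0`. -/
def initMem (w : List Bool) : Mem
  | 0 => w.length
  | i + 1 => (w.getD i false).toNat

/-- On the input word `w` the program halts after at most `T` steps, with a `1` in register `0`
if `P` holds (the machine accepts) and with a `0` there otherwise (it rejects). -/
def AnswersWithin (p : Prog) (w : List Bool) (P : Prop) (T : ℕ) : Prop :=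
  ∃ t m', t ≤ T ∧ Runs p (initMem w) t m' ∧ ((P ∧ m' 0 = 1) ∨ (¬ P ∧ m' 0 = 0))

end RAM

/-! ### Parameterized problems -/

/-- A parameterized decision problem: instances, written down as binary words, the set of
yes-instances, and the parameter. The parameter is not part of the input word. -/
structure ParamProblem where
  Instance : Type
  encode : Instance → List Bool
  encode_injective : Function.Injective encode
  IsYes : Instance → Prop
  param : Instance → ℕ

namespace ParamProblem

/-- The problem is decided by one random access machine in time `f(κ) · |x|^O(1)`, where `κ` is
the parameter and `|x|` the length of the input word. -/
def SolvableWith (Q : ParamProblem) (f : ℕ → ℕ) : Prop :=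
  ∃ (p : RAM.Prog) (c : ℕ), ∀ x : Q.Instance,
    RAM.AnswersWithin p (Q.encode x) (Q.IsYes x)
      (f (Q.param x) * ((Q.encode x).length + 1) ^ c)

/-- Fixed-parameter tractability. -/
def IsFPT (Q : ParamProblem) : Prop :=
  ∃ f : ℕ → ℕ, Computable f ∧ Q.SolvableWith f

end ParamProblem

/-! ### Equitable colorings and the distance to cluster -/

namespace SimpleGraph

/-- `G` has a proper coloring with `k` colors in which every color is used at least `⌊n / k⌋`
and at most `⌈n / k⌉` times, `n` being the number of vertices. -/
def EquitablyColorable {V : Type*} [Fintype V] (G : SimpleGraph V) (k : ℕ) : Prop :=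
  ∃ φ : G.Coloring (Fin k), ∀ i : Fin k,
    Fintype.card V / k ≤ {v : V | φ v = i}.ncard ∧
      {v : V | φ v = i}.ncard ≤ Fintype.card V ⌈/⌉ k

/-- A cluster graph: every connected component is a clique. -/
def IsCluster {V : Type*} (G : SimpleGraph V) : Prop :=
  ∀ C : G.ConnectedComponent, G.IsClique C.supp

/-- The distance to cluster: the least size of a set of vertices whose removal leaves a cluster
graph. -/
noncomputable def distToCluster {V : Type*} [Fintype V] (G : SimpleGraph V) : ℕ :=
  sInf {d : ℕ | ∃ U : Finset V, U.card = d ∧ (G.induce ((U : Set V)ᶜ)).IsCluster}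

end SimpleGraph

/-! ### The problem Equitable Coloring, parameterized by the distance to cluster -/

/-- An instance of Equitable Coloring: a finite graph, with vertices `0, …, n - 1`, and the number
of colors. -/
structure EqColInstance where
  n : ℕ
  G : SimpleGraph (Fin n)
  k : ℕ

namespace EqColInstance

open Classical in
/-- The adjacency matrix, row by row. -/
noncomputable def adjBits {n : ℕ} (G : SimpleGraph (Fin n)) : List Bool :=
  (List.finRange n).flatMap fun i => (List.finRange n).map fun j => decide (G.Adj i j)

/-- The input word: `n` in unary, a separating `0`, the adjacency matrix, and the number of
colors in binary (least significant bit first). -/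
noncomputable def encode (x : EqColInstance) : List Bool :=
  List.replicate x.n true ++ false :: (adjBits x.G ++ x.k.bits)

theorem replicate_append_inj {a b : ℕ} {u v : List Bool}
    (h : List.replicate a true ++ false :: u = List.replicate b true ++ false :: v) :
    a = b ∧ u = v := by
  induction a generalizing b with
  | zero =>
    cases b with
    | zero => simpa using h
    | succ b => simp [List.replicate_succ] at h
  | succ a ih =>
    cases b with
    | zero => simp [List.replicate_succ] at h
    | succ b =>
      simp only [List.replicate_succ, List.cons_append, List.cons.injEq, true_and] at h
      obtain ⟨rfl, rfl⟩ := ih h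
      exact ⟨rfl, rfl⟩

theorem length_adjBits {n : ℕ} (G : SimpleGraph (Fin n)) : (adjBits G).length = n * n := by
  simp [adjBits, List.length_flatMap]

theorem adjBits_injective {n : ℕ} :
    Function.Injective (adjBits : SimpleGraph (Fin n) → List Bool) := by
  classical
  intro G H h
  have key : ∀ (l : List (Fin n)) (f g : Fin n → Fin n → Bool),
      (l.flatMap fun i => (List.finRange n).map (f i)) =
        (l.flatMap fun i => (List.finRange n).map (g i)) → ∀ i ∈ l, ∀ j, f i j = g i j := by
    intro l f g
    induction l with
    | nil => simp
    | cons a l ih =>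
      intro h
      simp only [List.flatMap_cons] at h
      obtain ⟨h₁, h₂⟩ := List.append_inj h (by simp)
      intro i hi j
      rcases List.mem_cons.mp hi with rfl | hi
      · exact List.map_inj_left.mp h₁ j (List.mem_finRange j)
      · exact ih h₂ i hi j
  ext i j
  simpa using key _ _ _ h i (List.mem_finRange i) j

theorem bits_injective : Function.Injective Nat.bits := by
  intro a
  induction a using Nat.binaryRec' with
  | zero =>
    intro b
    induction b using Nat.binaryRec' with
    | zero => simp
    | bit c b hb _ => simp [Nat.bits_append_bit b c hb]
  | bit d a ha ih =>
    intro b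
    induction b using Nat.binaryRec' with
    | zero => simp [Nat.bits_append_bit a d ha]
    | bit c b hb _ =>
      rw [Nat.bits_append_bit a d ha, Nat.bits_append_bit b c hb]
      intro h
      obtain ⟨rfl, h'⟩ := List.cons.inj h
      rw [ih h']

theorem encode_injective : Function.Injective encode := by
  rintro ⟨n, G, k⟩ ⟨n', G', k'⟩ h
  obtain ⟨h₁, h₂⟩ := replicate_append_inj h
  dsimp only at h₁ h₂
  subst h₁
  obtain ⟨h₃, h₄⟩ := List.append_inj h₂ (by rw [length_adjBits, length_adjBits])
  rw [adjBits_injective h₃, bits_injective h₄]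

end EqColInstance

/-- Equitable Coloring, parameterized by the distance to cluster of the input graph. -/
noncomputable def equitableColoringByDistToCluster : ParamProblem where
  Instance := EqColInstance
  encode := EqColInstance.encode
  encode_injective := EqColInstance.encode_injective
  IsYes x := x.G.EquitablyColorable x.k
  param x := x.G.distToCluster

/-! ### Functions computable in polynomial time relative to a resource bound -/

namespace RAM

/-- `T` is bounded by a polynomial in the resource `B`. -/
def PolyBdd (B T : List Bool → ℕ) : Prop :=
  ∃ C D : ℕ, ∀ w, T w ≤ C * (B w + 1) ^ D

namespace PolyBdd

variable {B T T' : List Bool → ℕ}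

theorem mono (h : PolyBdd B T') (hle : ∀ w, T w ≤ T' w) : PolyBdd B T := by
  obtain ⟨C, D, hC⟩ := h
  exact ⟨C, D, fun w => (hle w).trans (hC w)⟩

theorem const (c : ℕ) : PolyBdd B fun _ => c := ⟨c, 0, fun w => by simp⟩

theorem self : PolyBdd B B := ⟨1, 1, fun w => by simp⟩

theorem add (h : PolyBdd B T) (h' : PolyBdd B T') : PolyBdd B fun w => T w + T' w := by
  obtain ⟨C, D, hC⟩ := h
  obtain ⟨C', D', hC'⟩ := h'
  refine ⟨C + C', max D D', fun w => ?_⟩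
  have h1 : (B w + 1) ^ D ≤ (B w + 1) ^ max D D' :=
    Nat.pow_le_pow_right (by omega) (le_max_left _ _)
  have h2 : (B w + 1) ^ D' ≤ (B w + 1) ^ max D D' :=
    Nat.pow_le_pow_right (by omega) (le_max_right _ _)
  calc T w + T' w ≤ C * (B w + 1) ^ D + C' * (B w + 1) ^ D' := add_le_add (hC w) (hC' w)
    _ ≤ C * (B w + 1) ^ max D D' + C' * (B w + 1) ^ max D D' := by gcongr
    _ = _ := by ring

theorem mul (h : PolyBdd B T) (h' : PolyBdd B T') : PolyBdd B fun w => T w * T' w := by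
  obtain ⟨C, D, hC⟩ := h
  obtain ⟨C', D', hC'⟩ := h'
  refine ⟨C * C', D + D', fun w => ?_⟩
  calc T w * T' w ≤ C * (B w + 1) ^ D * (C' * (B w + 1) ^ D') := Nat.mul_le_mul (hC w) (hC' w)
    _ = _ := by ring

end PolyBdd

/-- Contexts: an input word together with finitely many numerical variables. -/
class Ctx (α : Type) where
  word : α → List Bool
  size : ℕ
  var : α → ℕ → ℕ

instance : Ctx (List Bool) where
  word w := w
  size := 0
  var _ _ := 0

instance {α : Type} [Ctx α] : Ctx (α × ℕ) where
  word p := Ctx.word p.1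
  size := Ctx.size α + 1
  var p j := if j = Ctx.size α then p.2 else Ctx.var p.1 j

/-- The memory contains the input word in its lowest registers. -/
structure Loads (m : Mem) (w : List Bool) : Prop where
  len : m 0 = w.length
  bit : ∀ i < w.length, m (i + 1) = (w.getD i false).toNat

theorem Loads.congr {m m' : Mem} {w : List Bool} (h : Loads m w)
    (h' : ∀ i ≤ w.length, m' i = m i) : Loads m' w :=
  ⟨by rw [h' 0 (Nat.zero_le _), h.len], fun i hi => by rw [h' (i + 1) hi, h.bit i hi]⟩

theorem loads_initMem (w : List Bool) : Loads (initMem w) w := ⟨rfl, fun _ _ => rfl⟩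

/-- The memory contains the input word and, behind it, the variables of the context, the `j`-th
one in slot `pos j`. -/
def Holds {α : Type} [Ctx α] (m : Mem) (pos : ℕ → ℕ) (a : α) : Prop :=
  Loads m (Ctx.word a) ∧
    ∀ j < Ctx.size α, m ((Ctx.word a).length + (pos j + 1)) = Ctx.var a j

/-- The address of a slot behind the input word. -/
def slot (s : ℕ) : Expr := .add (.read (.const 0)) (.const (s + 1))

/-- The contents of a slot. -/
def get (s : ℕ) : Expr := .read (slot s)

/-- Assignment to a slot. -/
def put (s : ℕ) (e : Expr) : Prog := .store (slot s) e

/-- Started on `m`, the program halts within `T` steps with the value `v` in slot `s` and without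
changing anything below this slot. -/
def Yields (p : Prog) (m : Mem) (w : List Bool) (s v T : ℕ) : Prop :=
  ∃ t m', t ≤ T ∧ Runs p m t m' ∧ m' (w.length + (s + 1)) = v ∧
    ∀ i < w.length + (s + 1), m' i = m i

theorem Loads.eval_slot {m : Mem} {w : List Bool} (h : Loads m w) (s : ℕ) :
    (slot s).eval m = w.length + (s + 1) := by
  simp [slot, Expr.eval, h.len]

theorem Loads.eval_get {m : Mem} {w : List Bool} (h : Loads m w) (s : ℕ) :
    (get s).eval m = m (w.length + (s + 1)) := by
  simp [get, Expr.eval, h.eval_slot]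

theorem Loads.runs_put {m : Mem} {w : List Bool} (h : Loads m w) (s : ℕ) (e : Expr) :
    Runs (put s e) m (e.cost + 5)
      (Function.update m (w.length + (s + 1)) (e.eval m)) := by
  have := Runs.store (slot s) e m
  rw [h.eval_slot] at this
  have hc : (slot s).cost + e.cost + 1 = e.cost + 5 := by simp [slot, Expr.cost]; omega
  rwa [hc] at this

theorem Loads.yields_put {m : Mem} {w : List Bool} (h : Loads m w) (s : ℕ) (e : Expr) :
    Yields (put s e) m w s (e.eval m) (e.cost + 5) :=
  ⟨_, _, le_rfl, h.runs_put s e, by simp, fun i hi => by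
    rw [Function.update_of_ne (by omega)]⟩

theorem Loads.of_below {m m' : Mem} {w : List Bool} {s : ℕ} (h : Loads m w)
    (h' : ∀ i < w.length + (s + 1), m' i = m i) : Loads m' w :=
  h.congr fun i hi => h' i (by omega)

theorem Holds.of_below {α : Type} [Ctx α] {m m' : Mem} {pos : ℕ → ℕ} {a : α} {s : ℕ}
    (h : Holds m pos a) (hs : ∀ j < Ctx.size α, pos j < s)
    (h' : ∀ i < (Ctx.word a).length + (s + 1), m' i = m i) : Holds m' pos a :=
  ⟨h.1.of_below h', fun j hj => by
    rw [h' _ (by have := hs j hj; omega), h.2 j hj]⟩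

theorem Yields.seq {p q : Prog} {m : Mem} {w : List Bool} {s s' v v' T T' : ℕ}
    (hp : Yields p m w s v T) (hs : s' ≤ s)
    (hq : ∀ m', m' (w.length + (s + 1)) = v → (∀ i < w.length + (s + 1), m' i = m i) →
      Yields q m' w s' v' T') :
    Yields (p.seq q) m w s' v' (T + T') := by
  obtain ⟨t, m', ht, hr, hv, hb⟩ := hp
  obtain ⟨t', m'', ht', hr', hv', hb'⟩ := hq m' hv hb
  exact ⟨t + t', m'', by omega, .seq hr hr', hv', fun i hi => by
    rw [hb' i hi, hb i (by omega)]⟩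

/-- The function `f` of the variables of a context is computed by a program in time polynomial in
the resource `B`. -/
def Comp {α : Type} [Ctx α] (B : List Bool → ℕ) (f : α → ℕ) : Prop :=
  ∃ (p : (ℕ → ℕ) → ℕ → Prog) (T : List Bool → ℕ), PolyBdd B T ∧
    ∀ (pos : ℕ → ℕ) (s : ℕ) (a : α) (m : Mem), (∀ j < Ctx.size α, pos j < s) → Holds m pos a →
      Yields (p pos s) m (Ctx.word a) s (f a) (T (Ctx.word a))

namespace Comp

variable {α : Type} [Ctx α] {B : List Bool → ℕ} {f g : α → ℕ}

theorem const (c : ℕ) : Comp B fun _ : α => c :=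
  ⟨fun _ s => put s (.const c), fun _ => 6, .const _, fun _ s _ _ _ h =>
    h.1.yields_put s (.const c)⟩

theorem length : Comp B fun a : α => (Ctx.word a).length := by
  refine ⟨fun _ s => put s (.read (.const 0)), fun _ => 7, .const _, fun pos s a m _ h => ?_⟩
  have := h.1.yields_put s (.read (.const 0))
  rw [Expr.eval, Expr.eval, h.1.len] at this
  exact this

theorem variable_ (j : ℕ) (hj : j < Ctx.size α) : Comp B fun a : α => Ctx.var a j := by
  refine ⟨fun pos s => put s (get (pos j)), fun _ => 10, .const _, fun pos s a m _ h => ?_⟩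
  have := h.1.yields_put s (get (pos j))
  rw [h.1.eval_get, h.2 j hj] at this
  exact this

theorem weaken (hf : Comp B f) : Comp B fun p : α × ℕ => f p.1 := by
  obtain ⟨p, T, hT, hp⟩ := hf
  refine ⟨p, T, hT, fun pos s a m hs h => ?_⟩
  refine hp pos s a.1 m (fun j hj => hs j (Nat.lt_succ_of_lt hj)) ⟨h.1, fun j hj => ?_⟩
  have := h.2 j (Nat.lt_succ_of_lt hj)
  simpa [Ctx.var, Ctx.word, hj.ne] using this

theorem app0 {F : List Bool → ℕ} (hF : Comp B F) : Comp B fun a : α => F (Ctx.word a) := by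
  obtain ⟨p, T, hT, hp⟩ := hF
  exact ⟨p, T, hT, fun pos s a m _ h => hp pos s (Ctx.word a) m
    (fun j hj => absurd hj (Nat.not_lt_zero j)) ⟨h.1, fun j hj => absurd hj (Nat.not_lt_zero j)⟩⟩

theorem binary {op : ℕ → ℕ → ℕ} {c : Expr → Expr → Expr} (hc : ∀ m e e', (c e e').eval m =
    op (e.eval m) (e'.eval m)) (hcost : ∀ e e', (c e e').cost = e.cost + e'.cost + 1)
    (hf : Comp B f) (hg : Comp B g) : Comp B fun a => op (f a) (g a) := by
  obtain ⟨p, T, hT, hp⟩ := hf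
  obtain ⟨q, T', hT', hq⟩ := hg
  refine ⟨fun pos s => (p pos s).seq ((q pos (s + 1)).seq (put s (c (get s) (get (s + 1))))),
    fun w => T w + (T' w + 16), hT.add (hT'.add (.const _)), fun pos s a m hs h => ?_⟩
  refine (hp pos s a m hs h).seq le_rfl fun m' hv hb => ?_
  have h' := h.of_below hs hb
  refine (hq pos (s + 1) a m' (fun j hj => (hs j hj).trans (Nat.lt_succ_self _)) h').seq
    (Nat.le_succ _) fun m'' hv' hb' => ?_
  have h'' : Loads m'' (Ctx.word a) := h'.1.of_below hb'
  have := h''.yields_put s (c (get s) (get (s + 1)))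
  rw [hc, h''.eval_get, h''.eval_get, hv', hb' _ (by omega), hv, hcost] at this
  exact this

theorem add (hf : Comp B f) (hg : Comp B g) : Comp B fun a => f a + g a :=
  binary (op := (· + ·)) (c := .add) (fun _ _ _ => rfl) (fun _ _ => rfl) hf hg

theorem sub (hf : Comp B f) (hg : Comp B g) : Comp B fun a => f a - g a :=
  binary (op := (· - ·)) (c := .sub) (fun _ _ _ => rfl) (fun _ _ => rfl) hf hg

/-- Letters of the input word. -/
theorem letter (hf : Comp B f) :
    Comp B fun a => ((Ctx.word a).getD (f a) false).toNat := by
  obtain ⟨p, T, hT, hp⟩ := hf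
  refine ⟨fun pos s => (p pos s).seq (.ite (.sub (.read (.const 0)) (get s))
    (put s (.read (.add (get s) (.const 1)))) (put s (.const 0))),
    fun w => T w + 22, hT.add (.const _), fun pos s a m hs h => ?_⟩
  refine (hp pos s a m hs h).seq le_rfl fun m' hv hb => ?_
  have h' : Loads m' (Ctx.word a) := h.1.of_below hb
  by_cases hlt : f a < (Ctx.word a).length
  · obtain ⟨t, m'', ht, hr, hv', hb'⟩ := h'.yields_put s (.read (.add (get s) (.const 1)))
    simp only [Expr.eval, h'.eval_get, hv, h'.bit _ hlt] at hv'
    refine ⟨_, m'', ?_, .ite_true ?_ hr, hv', hb'⟩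
    · simp [Expr.cost, get, slot] at ht ⊢; omega
    · simp only [Expr.eval, h'.eval_get, hv, h'.len]; omega
  · obtain ⟨t, m'', ht, hr, hv', hb'⟩ := h'.yields_put s (.const 0)
    refine ⟨_, m'', ?_, .ite_false ?_ hr, ?_, hb'⟩
    · simp [Expr.cost, get, slot] at ht ⊢; omega
    · simp only [Expr.eval, h'.eval_get, hv, h'.len]; omega
    · dsimp only
      rw [hv', List.getD_eq_default _ _ (by omega)]; rfl

theorem cond {c : α → ℕ} (hc : Comp B c) (hf : Comp B f) (hg : Comp B g) :
    Comp B fun a => if c a ≠ 0 then f a else g a := by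
  obtain ⟨r, T₀, hT₀, hr⟩ := hc
  obtain ⟨p, T, hT, hp⟩ := hf
  obtain ⟨q, T', hT', hq⟩ := hg
  refine ⟨fun pos s => (r pos s).seq (.ite (get s) (p pos s) (q pos s)),
    fun w => T₀ w + (6 + (T w + T' w)), hT₀.add ((PolyBdd.const _).add (hT.add hT')),
    fun pos s a m hs h => ?_⟩
  refine (hr pos s a m hs h).seq le_rfl fun m' hv hb => ?_
  have h' := h.of_below hs hb
  have hcost : (get s).cost = 5 := rfl
  by_cases h0 : c a ≠ 0
  · obtain ⟨t, m'', ht, hr, hv', hb'⟩ := hp pos s a m' hs h'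
    dsimp only
    rw [if_pos h0]
    exact ⟨_, m'', by omega, .ite_true (by rwa [h'.1.eval_get, hv]) hr, hv', hb'⟩
  · obtain ⟨t, m'', ht, hr, hv', hb'⟩ := hq pos s a m' hs h'
    dsimp only
    rw [if_neg h0]
    exact ⟨_, m'', by omega, .ite_false (by rw [h'.1.eval_get, hv]; omega) hr, hv', hb'⟩

theorem holds_snoc {m : Mem} {pos : ℕ → ℕ} {a : α} {s v : ℕ} (h : Holds m pos a)
    (hv : m ((Ctx.word a).length + (s + 1)) = v) :
    Holds m (Function.update pos (Ctx.size α) s) (a, v) := by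
  refine ⟨h.1, fun j hj => ?_⟩
  by_cases hj' : j = Ctx.size α
  · subst hj'
    simpa [Ctx.var, Ctx.word] using hv
  · have : j < Ctx.size α := by simp only [Ctx.size] at hj; omega
    simpa [Ctx.var, Ctx.word, hj'] using h.2 j this

theorem update_lt {pos : ℕ → ℕ} {k s v s' : ℕ} (h : ∀ j < k, pos j < s) (hv : v < s')
    (hs : s ≤ s') : ∀ j < k + 1, Function.update pos k v j < s' := by
  intro j hj
  by_cases hj' : j = k
  · subst hj'; simpa using hv
  · rw [Function.update_of_ne hj']
    have := h j (by omega)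
    omega

/-- Bounded recursion. -/
theorem iter {n : α → ℕ} {b : α → ℕ → ℕ → ℕ} {N : List Bool → ℕ} (hn : Comp B n)
    (hN : PolyBdd B N) (hle : ∀ a, n a ≤ N (Ctx.word a)) (hf : Comp B f)
    (hb : Comp B fun p : (α × ℕ) × ℕ => b p.1.1 p.1.2 p.2) :
    Comp B fun a => Nat.rec (motive := fun _ => ℕ) (f a) (b a) (n a) := by
  obtain ⟨r, T₀, hT₀, hr⟩ := hn
  obtain ⟨p, T, hT, hp⟩ := hf
  obtain ⟨q, T', hT', hq⟩ := hb
  let body : (ℕ → ℕ) → ℕ → Prog := fun pos s =>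
    (q (Function.update (Function.update pos (Ctx.size α) (s + 2)) (Ctx.size α + 1) (s + 1))
      (s + 3)).seq ((put (s + 1) (get (s + 3))).seq
        ((put (s + 2) (.add (get (s + 2)) (.const 1))).seq
          (put s (.sub (get s) (.const 1)))))
  have hloop : ∀ (pos : ℕ → ℕ) (s : ℕ) (a : α), (∀ j < Ctx.size α, pos j < s) →
      ∀ (d i : ℕ) (m : Mem), Holds m pos a → d + i = n a →
        m ((Ctx.word a).length + (s + 1)) = d →
        m ((Ctx.word a).length + (s + 2)) = Nat.rec (motive := fun _ => ℕ) (f a) (b a) i →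
        m ((Ctx.word a).length + (s + 3)) = i →
        ∃ t m', t ≤ d * (T' (Ctx.word a) + 40) + 6 ∧ Runs (.loop (get s) (body pos s)) m t m' ∧
          Loads m' (Ctx.word a) ∧
          m' ((Ctx.word a).length + (s + 2)) =
            Nat.rec (motive := fun _ => ℕ) (f a) (b a) (n a) ∧
          ∀ i < (Ctx.word a).length + (s + 1), m' i = m i := by
    intro pos s a hs d
    set L := (Ctx.word a).length with hL
    induction d with
    | zero =>
      intro i m h hi h1 h2 h3
      refine ⟨_, m, ?_, .loop_done ?_, h.1, ?_, fun _ _ => rfl⟩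
      · simp [get, slot, Expr.cost]
      · rw [h.1.eval_get, h1]
      · rw [h2, ← hi, zero_add]
    | succ d ih =>
      intro i m h hi h1 h2 h3
      have hlt : ∀ j < Ctx.size ((α × ℕ) × ℕ),
          Function.update (Function.update pos (Ctx.size α) (s + 2)) (Ctx.size α + 1) (s + 1) j
            < s + 3 :=
        update_lt (s := s + 3) (update_lt (s := s) hs (by omega) (by omega)) (by omega) le_rfl
      have hH : Holds m
          (Function.update (Function.update pos (Ctx.size α) (s + 2)) (Ctx.size α + 1) (s + 1))
          (((a, i), Nat.rec (motive := fun _ => ℕ) (f a) (b a) i) : (α × ℕ) × ℕ) :=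
        holds_snoc (α := α × ℕ) (holds_snoc h h3) h2
      obtain ⟨t₁, m₁, ht₁, hr₁, hv₁, hb₁⟩ := hq _ (s + 3) _ m hlt hH
      simp only [Ctx.word] at hv₁ hb₁ ht₁
      have l₁ : Loads m₁ (Ctx.word a) := h.1.of_below hb₁
      have r₂ := l₁.runs_put (s + 1) (get (s + 3))
      rw [l₁.eval_get, hv₁] at r₂
      set m₂ := Function.update m₁ ((Ctx.word a).length + (s + 1 + 1))
        (b a i (Nat.rec (motive := fun _ => ℕ) (f a) (b a) i)) with hm₂
      have l₂ : Loads m₂ (Ctx.word a) := l₁.congr fun i hi => by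
        rw [hm₂, Function.update_of_ne (by omega)]
      have r₃ := l₂.runs_put (s + 2) (.add (get (s + 2)) (.const 1))
      have e₃ : (Expr.add (get (s + 2)) (.const 1)).eval m₂ = i + 1 := by
        simp only [Expr.eval, l₂.eval_get]
        rw [hm₂, Function.update_of_ne (by omega), hb₁ _ (by omega), h3]
      rw [e₃] at r₃
      set m₃ := Function.update m₂ ((Ctx.word a).length + (s + 2 + 1)) (i + 1) with hm₃
      have l₃ : Loads m₃ (Ctx.word a) := l₂.congr fun i hi => by
        rw [hm₃, Function.update_of_ne (by omega)]
      have r₄ := l₃.runs_put s (.sub (get s) (.const 1))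
      have e₄ : (Expr.sub (get s) (.const 1)).eval m₃ = d := by
        simp only [Expr.eval, l₃.eval_get]
        rw [hm₃, Function.update_of_ne (by omega), hm₂, Function.update_of_ne (by omega),
          hb₁ _ (by omega), ← hL, h1]
        rfl
      rw [e₄] at r₄
      set m₄ := Function.update m₃ ((Ctx.word a).length + (s + 1)) d with hm₄
      have below : ∀ i < (Ctx.word a).length + (s + 1), m₄ i = m i := fun i hi => by
        rw [hm₄, Function.update_of_ne (by omega), hm₃, Function.update_of_ne (by omega), hm₂,
          Function.update_of_ne (by omega), hb₁ _ (by omega)]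
      obtain ⟨t, m', ht, hr', hl, hv, hb'⟩ := ih (i + 1) m₄ (h.of_below hs below) (by omega)
        (by rw [hm₄, hL, Function.update_self])
        (by rw [hm₄, hL, Function.update_of_ne (by omega), hm₃, Function.update_of_ne (by omega),
              hm₂, show s + 2 = s + 1 + 1 by omega, Function.update_self])
        (by rw [hm₄, hL, Function.update_of_ne (by omega), hm₃,
              show s + 3 = s + 2 + 1 by omega, Function.update_self])
      refine ⟨_, m', ?_, .loop_step ?_ (.seq hr₁ (.seq r₂ (.seq r₃ r₄))) hr', hl, hv, ?_⟩
      · have c1 : ∀ s, (get s).cost = 5 := fun _ => rfl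
        simp only [Expr.cost, c1]
        rw [Nat.succ_mul]
        omega
      · rw [h.1.eval_get, ← hL, h1]; omega
      · intro i hi
        rw [hb' i hi, below i hi]
  refine ⟨fun pos s => (r pos s).seq ((p pos (s + 1)).seq ((put (s + 2) (.const 0)).seq
    ((Prog.loop (get s) (body pos s)).seq (put s (get (s + 1)))))),
    fun w => T₀ w + (T w + (N w * (T' w + 40) + 22)),
    hT₀.add (hT.add ((hN.mul (hT'.add (.const _))).add (.const _))), fun pos s a m hs h => ?_⟩
  refine (hr pos s a m hs h).seq le_rfl fun m' hv hb => ?_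
  have h' := h.of_below hs hb
  have hs' : ∀ j < Ctx.size α, pos j < s + 1 := fun j hj => (hs j hj).trans (Nat.lt_succ_self _)
  refine (hp pos (s + 1) a m' hs' h').seq (Nat.le_succ _) fun m'' hv' hb' => ?_
  have h'' := h'.of_below hs' hb'
  have r₃ := h''.1.runs_put (s + 2) (.const 0)
  set m₃ := Function.update m'' ((Ctx.word a).length + (s + 2 + 1)) ((Expr.const 0).eval m'')
    with hm₃
  have hb₃ : ∀ i < (Ctx.word a).length + (s + 3), m₃ i = m'' i := fun i hi => by
    rw [hm₃, Function.update_of_ne (by omega)]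
  obtain ⟨t, m₄, ht, hr₄, hl, hv₄, hb₄⟩ := hloop pos s a hs (n a) 0 m₃
    (h''.of_below hs fun i hi => hb₃ i (by omega)) (by simp)
    (by rw [hb₃ _ (by omega), hb' _ (by omega), hv])
    (by rw [hb₃ _ (by omega)]; exact hv')
    (by rw [hm₃, show s + 3 = s + 2 + 1 by omega, Function.update_self]; rfl)
  obtain ⟨t₅, m₅, ht₅, hr₅, hv₅, hb₅⟩ := hl.yields_put s (get (s + 1))
  rw [hl.eval_get] at hv₅
  refine ⟨_, m₅, ?_, .seq r₃ (.seq hr₄ hr₅), hv₅.trans hv₄, fun i hi => ?_⟩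
  · have c1 : ∀ s, (get s).cost = 5 := fun _ => rfl
    have : n a * (T' (Ctx.word a) + 40) ≤ N (Ctx.word a) * (T' (Ctx.word a) + 40) :=
      Nat.mul_le_mul_right _ (hle a)
    simp only [Expr.cost, c1] at ht₅ ⊢
    omega
  · rw [hb₅ i hi, hb₄ i hi, hb₃ i (by omega)]

end Comp

/-- A computable function of the input word is computed by a program that leaves its value in
register `0`. -/
theorem Comp.exists_prog {B f : List Bool → ℕ} (hf : Comp B f) :
    ∃ (p : Prog) (C D : ℕ), ∀ w, ∃ t m', t ≤ C * (B w + 1) ^ D ∧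
      Runs p (initMem w) t m' ∧ m' 0 = f w := by
  obtain ⟨p, T, hT, hp⟩ := hf
  obtain ⟨C, D, hC⟩ := hT.add (PolyBdd.const (B := B) 7)
  refine ⟨(p id 0).seq (.store (.const 0) (get 0)), C, D, fun w => ?_⟩
  obtain ⟨t, m', ht, hr, hv, hb⟩ := hp id 0 w (initMem w)
    (fun j hj => absurd hj (Nat.not_lt_zero _))
    ⟨loads_initMem w, fun j hj => absurd hj (Nat.not_lt_zero _)⟩
  have l : Loads m' w := (loads_initMem w).of_below hb
  refine ⟨_, _, le_trans ?_ (hC w), .seq hr (.store (.const 0) (get 0) m'), ?_⟩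
  · have c1 : ∀ s, (get s).cost = 5 := fun _ => rfl
    simp only [Expr.cost, c1]
    have : t ≤ T w := ht
    omega
  · have h1 := l.eval_get 0
    rw [show m' (w.length + (0 + 1)) = f w from hv] at h1
    simp [Expr.eval, h1]

end RAM

/-! ### Bounded quantifiers, counting and arithmetic -/

namespace RAM

open Finset

/-- Computable and bounded by a polynomial in the resource. -/
def Small {α : Type} [Ctx α] (B : List Bool → ℕ) (n : α → ℕ) : Prop :=
  Comp B n ∧ ∃ N, PolyBdd B N ∧ ∀ a, n a ≤ N (Ctx.word a)

open Classical in
/-- Decidable in time polynomial in the resource. -/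
def CompP {α : Type} [Ctx α] (B : List Bool → ℕ) (P : α → Prop) : Prop :=
  Comp B fun a => if P a then 1 else 0

section

variable {α : Type} [Ctx α] {B : List Bool → ℕ} {f g n : α → ℕ} {P Q : α → Prop}

theorem Comp.of_eq (hf : Comp B f) (h : ∀ a, f a = g a) : Comp B g := funext h ▸ hf

theorem CompP.of_iff (hP : CompP B P) (h : ∀ a, P a ↔ Q a) : CompP B Q :=
  funext (fun a => propext (h a)) ▸ hP

theorem Comp.ite [DecidablePred P] (hP : CompP B P) (hf : Comp B f) (hg : Comp B g) :
    Comp B fun a => if P a then f a else g a :=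
  (Comp.cond hP hf hg).of_eq fun a => by by_cases h : P a <;> simp [h]

theorem CompP.ne_zero (hf : Comp B f) : CompP B fun a => f a ≠ 0 :=
  (Comp.cond hf (.const 1) (.const 0)).of_eq fun a => by by_cases h : f a = 0 <;> simp [h]

theorem CompP.not (hP : CompP B P) : CompP B fun a => ¬ P a := by
  classical
  exact (Comp.ite hP (.const 0) (.const 1)).of_eq fun a => by by_cases h : P a <;> simp [h]

theorem CompP.and (hP : CompP B P) (hQ : CompP B Q) : CompP B fun a => P a ∧ Q a := by
  classical
  exact (Comp.ite hP hQ (.const 0)).of_eq fun a => by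
    by_cases h : P a <;> by_cases h' : Q a <;> simp [h, h']

theorem CompP.or (hP : CompP B P) (hQ : CompP B Q) : CompP B fun a => P a ∨ Q a :=
  (hP.not.and hQ.not).not.of_iff fun a => by tauto

theorem CompP.imp (hP : CompP B P) (hQ : CompP B Q) : CompP B fun a => P a → Q a :=
  (hP.and hQ.not).not.of_iff fun a => by tauto

theorem CompP.lt (hf : Comp B f) (hg : Comp B g) : CompP B fun a => f a < g a :=
  (CompP.ne_zero (hg.sub hf)).of_iff fun a => by omega

theorem CompP.le (hf : Comp B f) (hg : Comp B g) : CompP B fun a => f a ≤ g a :=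
  (CompP.lt hg hf).not.of_iff fun _ => not_lt

theorem CompP.eq (hf : Comp B f) (hg : Comp B g) : CompP B fun a => f a = g a :=
  ((CompP.le hf hg).and (CompP.le hg hf)).of_iff fun a => by omega

theorem Comp.min (hf : Comp B f) (hg : Comp B g) : Comp B fun a => min (f a) (g a) :=
  (Comp.sub hf (hf.sub hg)).of_eq fun a => by omega

theorem Comp.max (hf : Comp B f) (hg : Comp B g) : Comp B fun a => max (f a) (g a) :=
  (Comp.add hf (hg.sub hf)).of_eq fun a => by omega

theorem Comp.rec (hn : Small B n) {b : α → ℕ → ℕ → ℕ} (hf : Comp B f)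
    (hb : Comp B fun p : (α × ℕ) × ℕ => b p.1.1 p.1.2 p.2) :
    Comp B fun a => Nat.rec (motive := fun _ => ℕ) (f a) (b a) (n a) := by
  obtain ⟨h, N, hN, hle⟩ := hn
  exact Comp.iter h hN hle hf hb

theorem Comp.var0 : Comp B fun p : α × ℕ => p.2 :=
  (Comp.variable_ (α := α × ℕ) (Ctx.size α) (Nat.lt_succ_self _)).of_eq fun a => by
    simp [Ctx.var]

theorem Comp.var1 : Comp B fun p : (α × ℕ) × ℕ => p.1.2 := Comp.var0.weaken

theorem Comp.var2 : Comp B fun p : ((α × ℕ) × ℕ) × ℕ => p.1.1.2 := Comp.var1.weaken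

theorem Comp.sum (hn : Small B n) {h : α → ℕ → ℕ} (hh : Comp B fun p : α × ℕ => h p.1 p.2) :
    Comp B fun a => ∑ i ∈ range (n a), h a i :=
  (Comp.rec hn (.const 0) (b := fun a i acc => acc + h a i)
    (Comp.var0.add hh.weaken)).of_eq fun a => by
    induction n a with
    | zero => rfl
    | succ k ih => rw [Finset.sum_range_succ, ← ih]

theorem Comp.sup (hn : Small B n) {h : α → ℕ → ℕ} (hh : Comp B fun p : α × ℕ => h p.1 p.2) :
    Comp B fun a => (range (n a)).sup (h a) :=
  (Comp.rec hn (.const 0) (b := fun a i acc => Max.max acc (h a i))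
    (Comp.var0.max hh.weaken)).of_eq fun a => by
    induction n a with
    | zero => rfl
    | succ k ih => rw [Finset.range_add_one, Finset.sup_insert, ← ih]; exact max_comm _ _

theorem Comp.card (hn : Small B n) {R : α → ℕ → Prop} [∀ a, DecidablePred (R a)]
    (hR : CompP B fun p : α × ℕ => R p.1 p.2) :
    Comp B fun a => ((range (n a)).filter (R a)).card := by
  classical
  exact (Comp.sum hn (h := fun a i => if R a i then 1 else 0)
    (hR.of_eq fun a => by congr)).of_eq fun a => by rw [Finset.card_filter]

theorem CompP.exists_lt (hn : Small B n) {R : α → ℕ → Prop}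
    (hR : CompP B fun p : α × ℕ => R p.1 p.2) : CompP B fun a => ∃ i < n a, R a i := by
  classical
  refine (CompP.ne_zero (Comp.card hn hR)).of_iff fun a => ?_
  rw [Finset.card_ne_zero]
  constructor
  · rintro ⟨i, hi⟩
    simp only [Finset.mem_filter, Finset.mem_range] at hi
    exact ⟨i, hi⟩
  · rintro ⟨i, hi⟩
    exact ⟨i, by simpa only [Finset.mem_filter, Finset.mem_range] using hi⟩

theorem CompP.forall_lt (hn : Small B n) {R : α → ℕ → Prop}
    (hR : CompP B fun p : α × ℕ => R p.1 p.2) : CompP B fun a => ∀ i < n a, R a i :=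
  (CompP.exists_lt hn (R := fun a i => ¬ R a i) hR.not).not.of_iff fun a => by
    push Not; rfl

theorem Comp.mul (hn : Small B n) (hf : Comp B f) : Comp B fun a => n a * f a :=
  (Comp.sum hn (h := fun a _ => f a) hf.weaken).of_eq fun a => by simp

theorem Small.weaken (hn : Small B n) : Small B fun p : α × ℕ => n p.1 := by
  obtain ⟨h, N, hN, hle⟩ := hn
  exact ⟨h.weaken, N, hN, fun a => hle a.1⟩

theorem Small.const (c : ℕ) : Small B fun _ : α => c :=
  ⟨.const c, fun _ => c, .const c, fun _ => le_rfl⟩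

theorem Small.add (hf : Small B f) (hg : Small B g) : Small B fun a => f a + g a := by
  obtain ⟨h, N, hN, hle⟩ := hf
  obtain ⟨h', N', hN', hle'⟩ := hg
  exact ⟨h.add h', _, hN.add hN', fun a => add_le_add (hle a) (hle' a)⟩

theorem Small.mul (hf : Small B f) (hg : Small B g) : Small B fun a => f a * g a := by
  have hc := Comp.mul hf hg.1
  obtain ⟨h, N, hN, hle⟩ := hf
  obtain ⟨h', N', hN', hle'⟩ := hg
  exact ⟨hc, _, hN.mul hN', fun a => Nat.mul_le_mul (hle a) (hle' a)⟩

theorem Small.of_le (hf : Comp B f) (hg : Small B g) (h : ∀ a, f a ≤ g a) : Small B f := by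
  obtain ⟨_, N, hN, hle⟩ := hg
  exact ⟨hf, N, hN, fun a => (h a).trans (hle a)⟩

end

/-! ### Digits -/

section

/-- A bound for the number of binary digits of the numbers handled by the digit functions. -/
def width (w : List Bool) : ℕ := 3 * w.length

/-- `a * b`, for small `a`. -/
def mulW (w : List Bool) (a b : ℕ) : ℕ := min a (width w) * b

/-- `b ^ i`, for small `b` and `i`. -/
def powW (w : List Bool) (b i : ℕ) : ℕ := (min b (width w)) ^ (min i (width w))

/-- The remainder of `x` modulo `y`, by long division. -/
def modW (w : List Bool) (x y : ℕ) : ℕ :=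
  Nat.rec (motive := fun _ => ℕ) x
    (fun j acc => if y * 2 ^ (width w - 1 - j) ≤ acc then acc - y * 2 ^ (width w - 1 - j) else acc)
    (width w)

/-- The `i`-th digit of `x` in base `b`. -/
def digitW (w : List Bool) (b x i : ℕ) : ℕ :=
  ((range (min b (width w))).filter fun q =>
    mulW w (q + 1) (powW w b i) ≤ modW w x (powW w b (i + 1))).card

theorem modW_eq {w : List Bool} {x y : ℕ} (h : x < y * 2 ^ width w) : modW w x y = x % y := by
  have key : ∀ j ≤ width w,
      (Nat.rec (motive := fun _ => ℕ) x (fun j acc => if y * 2 ^ (width w - 1 - j) ≤ acc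
        then acc - y * 2 ^ (width w - 1 - j) else acc) j : ℕ) < y * 2 ^ (width w - j) ∧
      (Nat.rec (motive := fun _ => ℕ) x (fun j acc => if y * 2 ^ (width w - 1 - j) ≤ acc
        then acc - y * 2 ^ (width w - 1 - j) else acc) j : ℕ) % y = x % y := by
    intro j
    induction j with
    | zero => intro _; exact ⟨by simpa using h, rfl⟩
    | succ j ih =>
      intro hj
      obtain ⟨h1, h2⟩ := ih (by omega)
      have e : width w - j = (width w - 1 - j) + 1 := by omega
      rw [e, pow_succ, ← mul_assoc] at h1
      rw [show width w - (j + 1) = width w - 1 - j by omega]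
      dsimp only
      split_ifs with hc
      · refine ⟨by omega, ?_⟩
        rw [← h2]
        exact Nat.sub_mul_mod hc
      · exact ⟨by omega, h2⟩
  obtain ⟨h1, h2⟩ := key (width w) le_rfl
  rw [Nat.sub_self, pow_zero, mul_one] at h1
  rw [Nat.mod_eq_of_lt h1] at h2
  exact h2

theorem digitW_eq {w : List Bool} {b x i : ℕ} (hb0 : 0 < b) (hb : b ≤ width w)
    (hi : i < width w) (hx : x < 2 ^ width w) : digitW w b x i = x / b ^ i % b := by
  have hp : 0 < b ^ i := Nat.pow_pos hb0
  have hp' : 0 < b ^ (i + 1) := Nat.pow_pos hb0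
  have e1 : powW w b i = b ^ i := by rw [powW, min_eq_left hb, min_eq_left hi.le]
  have e2 : powW w b (i + 1) = b ^ (i + 1) := by
    rw [powW, min_eq_left hb, min_eq_left (by omega)]
  have e3 : modW w x (b ^ (i + 1)) = x % (b ^ i * b) := by
    rw [modW_eq (hx.trans_le (Nat.le_mul_of_pos_left _ hp')), pow_succ]
  rw [digitW, e1, e2, e3, min_eq_left hb, ← Nat.mod_mul_right_div_self]
  set y := x % (b ^ i * b) with hy
  have hlt : y / b ^ i < b := by
    rw [hy, Nat.mod_mul_right_div_self]; exact Nat.mod_lt _ hb0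
  have : ((range b).filter fun q => mulW w (q + 1) (b ^ i) ≤ y) = range (y / b ^ i) := by
    ext q
    simp only [mem_filter, mem_range]
    constructor
    · rintro ⟨hq, h⟩
      rw [mulW, min_eq_left (by omega)] at h
      exact (Nat.le_div_iff_mul_le hp).2 h
    · intro hq
      refine ⟨by omega, ?_⟩
      rw [mulW, min_eq_left (by omega)]
      exact (Nat.le_div_iff_mul_le hp).1 hq
  rw [this, card_range]

variable {α : Type} [Ctx α] {B : List Bool → ℕ} {f g h : α → ℕ}

theorem Small.length (hB : ∀ w, w.length ≤ B w) : Small B fun a : α => (Ctx.word a).length :=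
  ⟨.length, B, .self, fun _ => hB _⟩

theorem Small.width (hB : ∀ w, w.length ≤ B w) : Small B fun a : α => width (Ctx.word a) :=
  (Small.const 3).mul (.length hB)

theorem Small.min_width (hB : ∀ w, w.length ≤ B w) (hf : Comp B f) :
    Small B fun a : α => min (f a) (RAM.width (Ctx.word a)) :=
  .of_le (hf.min (Small.width hB).1) (.width hB) fun _ => min_le_right _ _

theorem Comp.mulW (hB : ∀ w, w.length ≤ B w) (hf : Comp B f) (hg : Comp B g) :
    Comp B fun a => mulW (Ctx.word a) (f a) (g a) :=
  Comp.mul (.min_width hB hf) hg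

theorem Comp.powW (hB : ∀ w, w.length ≤ B w) (hf : Comp B f) (hg : Comp B g) :
    Comp B fun a => powW (Ctx.word a) (f a) (g a) := by
  have hf' : Small B fun a : α => Min.min (f a) (width (Ctx.word a)) := .min_width hB hf
  refine (Comp.rec (.min_width hB hg) (.const 1)
    (b := fun a _ acc => Min.min (f a) (width (Ctx.word a)) * acc)
    (Comp.mul hf'.weaken.weaken .var0)).of_eq fun a => ?_
  rw [RAM.powW]
  induction Min.min (g a) (width (Ctx.word a)) with
  | zero => rfl
  | succ k ih => rw [pow_succ', ← ih]

theorem Comp.mul_two_pow {n : α → ℕ} (hn : Small B n) (hf : Comp B f) :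
    Comp B fun a => f a * 2 ^ n a := by
  refine (Comp.rec hn hf (b := fun _ _ acc => acc + acc) (Comp.var0.add .var0)).of_eq fun a => ?_
  induction n a with
  | zero => simp
  | succ k ih => rw [pow_succ, ← mul_assoc, ← ih, mul_two]

theorem Comp.modW (hB : ∀ w, w.length ≤ B w) (hf : Comp B f) (hg : Comp B g) :
    Comp B fun a => modW (Ctx.word a) (f a) (g a) := by
  have key : Comp B fun p : (α × ℕ) × ℕ =>
      g p.1.1 * 2 ^ (width (Ctx.word p.1.1) - 1 - p.1.2) :=
    Comp.mul_two_pow (.of_le (((Small.width hB).1.weaken.weaken.sub (.const 1)).sub .var1)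
      (Small.width hB).weaken.weaken fun a => by omega) hg.weaken.weaken
  exact Comp.rec (.width hB) hf (b := fun a j acc =>
    if g a * 2 ^ (width (Ctx.word a) - 1 - j) ≤ acc
    then acc - g a * 2 ^ (width (Ctx.word a) - 1 - j) else acc)
    (Comp.ite (CompP.le key .var0) (Comp.var0.sub key) .var0)

theorem Comp.digitW (hB : ∀ w, w.length ≤ B w) (hf : Comp B f) (hg : Comp B g) (hh : Comp B h) :
    Comp B fun a => digitW (Ctx.word a) (f a) (g a) (h a) :=
  Comp.card (R := fun a q => RAM.mulW (Ctx.word a) (q + 1) (RAM.powW (Ctx.word a) (f a) (h a)) ≤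
      RAM.modW (Ctx.word a) (g a) (RAM.powW (Ctx.word a) (f a) (h a + 1))) (.min_width hB hf)
    (CompP.le (Comp.mulW hB (Comp.var0.add (.const 1)) (Comp.powW hB hf hh).weaken)
      (Comp.modW hB hg (Comp.powW hB hf (hh.add (.const 1)))).weaken)

end

end RAM

/-! ### The algorithm -/

namespace EqColAlg

open Finset RAM

open scoped Classical

noncomputable section

/-- Letter number `i` of the word is a `1`. -/
def Bit (w : List Bool) (i : ℕ) : Prop := w.getD i false = true

/-- The number of leading `1`s: the number of vertices. -/
def order (w : List Bool) : ℕ :=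
  Nat.rec (motive := fun _ => ℕ) 0 (fun _ acc => if Bit w acc then acc + 1 else acc) w.length

/-- The number of colors. -/
def colors (w : List Bool) : ℕ :=
  ∑ i ∈ range w.length, if Bit w (order w + 1 + order w * order w + i) then powW w 2 i else 0

/-- The number of colors, cut off at the number of vertices. -/
def palette (w : List Bool) : ℕ := min (colors w) (order w)

def Adj (w : List Bool) (u v : ℕ) : Prop := Bit w (order w + 1 + (order w * u + v))

/-- The digits of `t` form an induced path. -/
def IsPath (w : List Bool) (t : ℕ) : Prop :=
  Adj w (digitW w (order w) t 0) (digitW w (order w) t 1) ∧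
    Adj w (digitW w (order w) t 1) (digitW w (order w) t 2) ∧
    ¬ Adj w (digitW w (order w) t 0) (digitW w (order w) t 2) ∧
    digitW w (order w) t 0 ≠ digitW w (order w) t 2

/-- The digits of `t` avoid the vertex set with the bit mask `x`. -/
def Avoids (w : List Bool) (t x : ℕ) : Prop :=
  ∀ i < 3, digitW w 2 x (digitW w (order w) t i) = 0

/-- Add the vertices of the triple `t` to the vertex set with the bit mask `x` if they form an
induced path outside of it. -/
def maskStep (w : List Bool) (t x : ℕ) : ℕ :=
  if IsPath w t ∧ Avoids w t x then x + ∑ i ∈ range 3, powW w 2 (digitW w (order w) t i) else x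

/-- The bit mask of a set of vertices whose removal leaves a cluster graph. -/
def mask (w : List Bool) : ℕ :=
  Nat.rec (motive := fun _ => ℕ) 0 (maskStep w) (order w * order w * order w)

/-- Membership in the modulator. -/
def Mod (w : List Bool) (v : ℕ) : Prop := v < order w ∧ digitW w 2 (mask w) v = 1

def modSize (w : List Bool) : ℕ := ((range (order w)).filter (Mod w)).card

def rank (w : List Bool) (v : ℕ) : ℕ := ((range (order w)).filter fun u => u < v ∧ Mod w u).card

/-- The number of codes for colorings of the modulator. -/
def colorCodes (w : List Bool) : ℕ := powW w (modSize w) (modSize w)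

/-- The number of codes for subsets of the first colors. -/
def setCodes (w : List Bool) : ℕ := powW w 2 (modSize w)

/-- The size of the color classes after padding. -/
def classSize (w : List Bool) : ℕ :=
  ((range (order w)).filter fun i => palette w * i < order w).card

/-- The number of vertices after padding. -/
def padOrder (w : List Bool) : ℕ := palette w * classSize w

/-- Adjacency after padding with a disjoint clique. -/
def PadAdj (w : List Bool) (u v : ℕ) : Prop :=
  (u < order w ∧ v < order w ∧ Adj w u v) ∨ (order w ≤ u ∧ order w ≤ v ∧ u ≠ v)

/-- The color of a vertex of the modulator in the coloring with code `y`. -/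
def color (w : List Bool) (y v : ℕ) : ℕ := digitW w (modSize w) y (rank w v)

def Proper (w : List Bool) (y : ℕ) : Prop :=
  ∀ u < order w, Mod w u → color w y u < palette w ∧
    ∀ v < order w, Mod w v → Adj w u v → color w y u ≠ color w y v

/-- The set of colors with code `(s, j)`: some of the first colors and the next `j` colors. -/
def InSet (w : List Bool) (s j c : ℕ) : Prop :=
  c < palette w ∧ ((c < modSize w ∧ digitW w 2 s c = 1) ∨ (modSize w ≤ c ∧ c < modSize w + j))

def SubsetCode (w : List Bool) (s j t i : ℕ) : Prop :=
  ∀ c < palette w, InSet w t i c → InSet w s j c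

/-- Vertex `v` may get color `c`. -/
def Free (w : List Bool) (y v c : ℕ) : Prop :=
  ∀ u < order w, Mod w u → color w y u = c → ¬ PadAdj w u v

/-- The least vertices of the cliques outside of the modulator. -/
def Rep (w : List Bool) (a : ℕ) : Prop :=
  ¬ Mod w a ∧ ∀ u < padOrder w, u < a → ¬ Mod w u → ¬ PadAdj w u a

/-- Vertex `v` lies in the clique of `a`. -/
def InClique (w : List Bool) (a v : ℕ) : Prop := ¬ Mod w v ∧ (v = a ∨ PadAdj w a v)

/-- The number of colors of a set exceeding the number of vertices of a clique for which they may
be used. -/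
def excess (w : List Bool) (y a t i : ℕ) : ℕ :=
  ((range (palette w)).filter (InSet w t i)).card -
    ((range (padOrder w)).filter fun v =>
      InClique w a v ∧ ∃ c < palette w, InSet w t i c ∧ Free w y v c).card

/-- The maximal excess of a subset of a set of colors. -/
def defect (w : List Bool) (y s j a : ℕ) : ℕ :=
  (range (setCodes w)).sup fun t => (range (palette w + 1)).sup fun i =>
    if SubsetCode w s j t i then excess w y a t i else 0

def numCliques (w : List Bool) : ℕ := ((range (padOrder w)).filter (Rep w)).card

/-- The number of cliques in which a color may be missing, plus the size of a class. -/
def supply (w : List Bool) (y c : ℕ) : ℕ :=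
  numCliques w + ((range (order w)).filter fun u => Mod w u ∧ color w y u = c).card

/-- The Hall condition for the extension of a coloring of the modulator. -/
def Extends (w : List Bool) (y : ℕ) : Prop :=
  (∀ c < palette w, classSize w ≤ supply w y c) ∧
    ∀ s < setCodes w, ∀ j < palette w + 1,
      (∑ a ∈ range (padOrder w), if Rep w a then defect w y s j a else 0) ≤
        ∑ c ∈ range (palette w), if InSet w s j c then supply w y c - classSize w else 0

def Accepts (w : List Bool) : Prop :=
  order w ≤ colors w ∨ 0 < colors w ∧ ∃ y < colorCodes w, Proper w y ∧ Extends w y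

/-- The resource bound. -/
def budget (w : List Bool) : ℕ := w.length + colorCodes w + setCodes w

theorem length_le_budget (w : List Bool) : w.length ≤ budget w := by unfold budget; omega

section

variable {α : Type} [Ctx α] {f g h f₁ f₂ f₃ f₄ : α → ℕ}

theorem compP_bit (hf : Comp budget f) : CompP budget fun a => Bit (Ctx.word a) (f a) :=
  (CompP.ne_zero hf.letter).of_iff fun a => by simp [Bit]

theorem small_order : Small budget fun a : α => order (Ctx.word a) := by
  refine Small.of_le ?_ (Small.length length_le_budget) fun a => ?_
  · exact Comp.rec (Small.length length_le_budget) (.const 0)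
      (b := fun a _ acc => if Bit (Ctx.word a) acc then acc + 1 else acc)
      (Comp.ite (compP_bit .var0) (Comp.var0.add (.const 1)) .var0)
  · rw [order]
    induction (Ctx.word a).length with
    | zero => exact le_rfl
    | succ k ih => dsimp only at ih ⊢; split_ifs <;> omega

theorem comp_order : Comp budget fun a : α => order (Ctx.word a) := small_order.1

theorem comp_colors : Comp budget fun a : α => colors (Ctx.word a) :=
  Comp.app0 (F := colors) <| Comp.sum (Small.length length_le_budget)
    (h := fun w i => if Bit w (order w + 1 + order w * order w + i) then powW w 2 i else 0)
    (Comp.ite (compP_bit (((comp_order.add (.const 1)).add (Comp.mul small_order comp_order)).add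
      .var0)) (Comp.powW length_le_budget (.const 2) .var0) (.const 0))

theorem small_palette : Small budget fun a : α => palette (Ctx.word a) :=
  .of_le (comp_colors.min comp_order) small_order fun _ => min_le_right _ _

theorem compP_adj (hf : Comp budget f) (hg : Comp budget g) :
    CompP budget fun a => Adj (Ctx.word a) (f a) (g a) :=
  compP_bit ((comp_order.add (.const 1)).add ((Comp.mul small_order hf).add hg))

theorem comp_digit_order (hf : Comp budget f) (hg : Comp budget g) :
    Comp budget fun a => digitW (Ctx.word a) (order (Ctx.word a)) (f a) (g a) :=
  Comp.digitW length_le_budget comp_order hf hg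

theorem compP_isPath (hf : Comp budget f) : CompP budget fun a => IsPath (Ctx.word a) (f a) :=
  have h0 := comp_digit_order hf (.const 0)
  have h1 := comp_digit_order hf (.const 1)
  have h2 := comp_digit_order hf (.const 2)
  (compP_adj h0 h1).and ((compP_adj h1 h2).and ((compP_adj h0 h2).not.and (CompP.eq h0 h2).not))

theorem compP_avoids (hf : Comp budget f) (hg : Comp budget g) :
    CompP budget fun a => Avoids (Ctx.word a) (f a) (g a) :=
  CompP.forall_lt (.const 3)
    (R := fun a i => digitW (Ctx.word a) 2 (g a)
      (digitW (Ctx.word a) (order (Ctx.word a)) (f a) i) = 0)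
    (CompP.eq (Comp.digitW length_le_budget (.const 2) hg.weaken
      (comp_digit_order hf.weaken .var0)) (.const 0))

theorem comp_mask : Comp budget fun a : α => mask (Ctx.word a) :=
  Comp.app0 (F := mask) <| Comp.rec ((small_order.mul small_order).mul small_order) (.const 0)
    (b := maskStep)
    (Comp.ite ((compP_isPath .var1).and (compP_avoids .var1 .var0))
      (Comp.var0.add (Comp.sum (.const 3) (α := (List Bool × ℕ) × ℕ)
        (h := fun p i => powW p.1.1 2 (digitW p.1.1 (order p.1.1) p.1.2 i))
        (Comp.powW length_le_budget (.const 2) (comp_digit_order .var2 .var0)))) .var0)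

theorem compP_mod (hf : Comp budget f) : CompP budget fun a => Mod (Ctx.word a) (f a) :=
  (CompP.lt hf comp_order).and
    (CompP.eq (Comp.digitW length_le_budget (.const 2) comp_mask hf) (.const 1))

theorem comp_modSize : Comp budget fun a : α => modSize (Ctx.word a) :=
  Comp.card small_order (R := fun a u => Mod (Ctx.word a) u) (compP_mod .var0)

theorem comp_rank (hf : Comp budget f) : Comp budget fun a => rank (Ctx.word a) (f a) :=
  Comp.card small_order (R := fun a u => u < f a ∧ Mod (Ctx.word a) u)
    ((CompP.lt .var0 hf.weaken).and (compP_mod .var0))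

theorem small_colorCodes : Small budget fun a : α => colorCodes (Ctx.word a) :=
  ⟨Comp.powW length_le_budget comp_modSize comp_modSize, budget, .self, fun _ => by
    dsimp only [budget]; omega⟩

theorem small_setCodes : Small budget fun a : α => setCodes (Ctx.word a) :=
  ⟨Comp.powW length_le_budget (.const 2) comp_modSize, budget, .self, fun _ => by
    dsimp only [budget]; omega⟩

theorem small_classSize : Small budget fun a : α => classSize (Ctx.word a) :=
  .of_le (Comp.card small_order (R := fun a i => palette (Ctx.word a) * i < order (Ctx.word a))
    (CompP.lt (Comp.mul small_palette .var0) comp_order)) small_order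
    fun _ => (card_filter_le _ _).trans (card_range _).le

theorem small_padOrder : Small budget fun a : α => padOrder (Ctx.word a) :=
  small_palette.mul small_classSize

theorem compP_padAdj (hf : Comp budget f) (hg : Comp budget g) :
    CompP budget fun a => PadAdj (Ctx.word a) (f a) (g a) :=
  ((CompP.lt hf comp_order).and ((CompP.lt hg comp_order).and (compP_adj hf hg))).or
    ((CompP.le comp_order hf).and ((CompP.le comp_order hg).and (CompP.eq hf hg).not))

theorem comp_color (hf : Comp budget f) (hg : Comp budget g) :
    Comp budget fun a => color (Ctx.word a) (f a) (g a) :=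
  Comp.digitW length_le_budget comp_modSize hf (comp_rank hg)

theorem compP_proper (hf : Comp budget f) : CompP budget fun a => Proper (Ctx.word a) (f a) :=
  CompP.forall_lt small_order
    (R := fun a u => Mod (Ctx.word a) u → color (Ctx.word a) (f a) u < palette (Ctx.word a) ∧
      ∀ v < order (Ctx.word a), Mod (Ctx.word a) v → Adj (Ctx.word a) u v →
        color (Ctx.word a) (f a) u ≠ color (Ctx.word a) (f a) v)
    ((compP_mod .var0).imp ((CompP.lt (comp_color hf.weaken .var0) small_palette.1).and
      (CompP.forall_lt small_order (α := α × ℕ)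
        (R := fun p v => Mod (Ctx.word p) v → Adj (Ctx.word p) p.2 v →
          color (Ctx.word p) (f p.1) p.2 ≠ color (Ctx.word p) (f p.1) v)
        ((compP_mod .var0).imp ((compP_adj .var1 .var0).imp
          (CompP.eq (comp_color hf.weaken.weaken .var1)
            (comp_color hf.weaken.weaken .var0)).not)))))

theorem compP_inSet (hf : Comp budget f) (hg : Comp budget g) (hh : Comp budget h) :
    CompP budget fun a => InSet (Ctx.word a) (f a) (g a) (h a) :=
  (CompP.lt hh small_palette.1).and
    (((CompP.lt hh comp_modSize).and
      (CompP.eq (Comp.digitW length_le_budget (.const 2) hf hh) (.const 1))).or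
    ((CompP.le comp_modSize hh).and (CompP.lt hh (comp_modSize.add hg))))

theorem compP_subsetCode (h₁ : Comp budget f₁) (h₂ : Comp budget f₂) (h₃ : Comp budget f₃)
    (h₄ : Comp budget f₄) :
    CompP budget fun a => SubsetCode (Ctx.word a) (f₁ a) (f₂ a) (f₃ a) (f₄ a) :=
  CompP.forall_lt small_palette
    (R := fun a c => InSet (Ctx.word a) (f₃ a) (f₄ a) c → InSet (Ctx.word a) (f₁ a) (f₂ a) c)
    ((compP_inSet h₃.weaken h₄.weaken .var0).imp (compP_inSet h₁.weaken h₂.weaken .var0))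

theorem compP_free (hf : Comp budget f) (hg : Comp budget g) (hh : Comp budget h) :
    CompP budget fun a => Free (Ctx.word a) (f a) (g a) (h a) :=
  CompP.forall_lt small_order
    (R := fun a u => Mod (Ctx.word a) u → color (Ctx.word a) (f a) u = h a →
      ¬ PadAdj (Ctx.word a) u (g a))
    ((compP_mod .var0).imp ((CompP.eq (comp_color hf.weaken .var0) hh.weaken).imp
      (compP_padAdj .var0 hg.weaken).not))

theorem compP_rep (hf : Comp budget f) : CompP budget fun a => Rep (Ctx.word a) (f a) :=
  (compP_mod hf).not.and (CompP.forall_lt small_padOrder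
    (R := fun a u => u < f a → ¬ Mod (Ctx.word a) u → ¬ PadAdj (Ctx.word a) u (f a))
    ((CompP.lt .var0 hf.weaken).imp ((compP_mod .var0).not.imp
      (compP_padAdj .var0 hf.weaken).not)))

theorem compP_inClique (hf : Comp budget f) (hg : Comp budget g) :
    CompP budget fun a => InClique (Ctx.word a) (f a) (g a) :=
  (compP_mod hg).not.and ((CompP.eq hg hf).or (compP_padAdj hf hg))

theorem comp_excess (h₁ : Comp budget f₁) (h₂ : Comp budget f₂) (h₃ : Comp budget f₃)
    (h₄ : Comp budget f₄) :
    Comp budget fun a => excess (Ctx.word a) (f₁ a) (f₂ a) (f₃ a) (f₄ a) :=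
  (Comp.card small_palette (R := fun a c => InSet (Ctx.word a) (f₃ a) (f₄ a) c)
    (compP_inSet h₃.weaken h₄.weaken .var0)).sub
  (Comp.card small_padOrder (R := fun a v => InClique (Ctx.word a) (f₂ a) v ∧
      ∃ c < palette (Ctx.word a), InSet (Ctx.word a) (f₃ a) (f₄ a) c ∧
        Free (Ctx.word a) (f₁ a) v c)
    ((compP_inClique h₂.weaken .var0).and
      (CompP.exists_lt small_palette (α := α × ℕ)
        (R := fun p c => InSet (Ctx.word p) (f₃ p.1) (f₄ p.1) c ∧
          Free (Ctx.word p) (f₁ p.1) p.2 c)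
        ((compP_inSet h₃.weaken.weaken h₄.weaken.weaken .var0).and
          (compP_free h₁.weaken.weaken .var1 .var0)))))

theorem comp_defect (h₁ : Comp budget f₁) (h₂ : Comp budget f₂) (h₃ : Comp budget f₃)
    (h₄ : Comp budget f₄) :
    Comp budget fun a => defect (Ctx.word a) (f₁ a) (f₂ a) (f₃ a) (f₄ a) :=
  Comp.sup small_setCodes
    (h := fun a t => (range (palette (Ctx.word a) + 1)).sup fun i =>
      if SubsetCode (Ctx.word a) (f₂ a) (f₃ a) t i
      then excess (Ctx.word a) (f₁ a) (f₄ a) t i else 0)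
    (Comp.sup (small_palette.add (.const 1)) (α := α × ℕ)
      (h := fun p i => if SubsetCode (Ctx.word p) (f₂ p.1) (f₃ p.1) p.2 i
        then excess (Ctx.word p) (f₁ p.1) (f₄ p.1) p.2 i else 0)
      (Comp.ite (compP_subsetCode h₂.weaken.weaken h₃.weaken.weaken .var1 .var0)
        (comp_excess h₁.weaken.weaken h₄.weaken.weaken .var1 .var0) (.const 0)))

theorem comp_numCliques : Comp budget fun a : α => numCliques (Ctx.word a) :=
  Comp.card small_padOrder (R := fun a v => Rep (Ctx.word a) v) (compP_rep .var0)

theorem comp_supply (hf : Comp budget f) (hg : Comp budget g) :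
    Comp budget fun a => supply (Ctx.word a) (f a) (g a) :=
  comp_numCliques.add (Comp.card small_order
    (R := fun a u => Mod (Ctx.word a) u ∧ color (Ctx.word a) (f a) u = g a)
    ((compP_mod .var0).and (CompP.eq (comp_color hf.weaken .var0) hg.weaken)))

theorem compP_extends (hf : Comp budget f) : CompP budget fun a => Extends (Ctx.word a) (f a) :=
  (CompP.forall_lt small_palette
    (R := fun a c => classSize (Ctx.word a) ≤ supply (Ctx.word a) (f a) c)
    (CompP.le small_classSize.1 (comp_supply hf.weaken .var0))).and
  (CompP.forall_lt small_setCodes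
    (R := fun a s => ∀ j < palette (Ctx.word a) + 1,
      (∑ b ∈ range (padOrder (Ctx.word a)),
        if Rep (Ctx.word a) b then defect (Ctx.word a) (f a) s j b else 0) ≤
        ∑ c ∈ range (palette (Ctx.word a)), if InSet (Ctx.word a) s j c
          then supply (Ctx.word a) (f a) c - classSize (Ctx.word a) else 0)
    (CompP.forall_lt (small_palette.add (.const 1)) (α := α × ℕ)
      (R := fun p j =>
        (∑ b ∈ range (padOrder (Ctx.word p)),
          if Rep (Ctx.word p) b then defect (Ctx.word p) (f p.1) p.2 j b else 0) ≤
          ∑ c ∈ range (palette (Ctx.word p)), if InSet (Ctx.word p) p.2 j c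
            then supply (Ctx.word p) (f p.1) c - classSize (Ctx.word p) else 0)
      (CompP.le
        (Comp.sum small_padOrder (α := (α × ℕ) × ℕ)
          (h := fun p b => if Rep (Ctx.word p) b
            then defect (Ctx.word p) (f p.1.1) p.1.2 p.2 b else 0)
          (Comp.ite (compP_rep .var0)
            (comp_defect hf.weaken.weaken.weaken .var2 .var1 .var0) (.const 0)))
        (Comp.sum small_palette (α := (α × ℕ) × ℕ)
          (h := fun p c => if InSet (Ctx.word p) p.1.2 p.2 c
            then supply (Ctx.word p) (f p.1.1) c - classSize (Ctx.word p) else 0)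
          (Comp.ite (compP_inSet .var2 .var1 .var0)
            ((comp_supply hf.weaken.weaken.weaken .var0).sub small_classSize.1) (.const 0))))))

end

theorem compP_accepts : CompP budget Accepts :=
  (CompP.le (α := List Bool) comp_order comp_colors).or
    ((CompP.lt (.const 0) comp_colors).and
      (CompP.exists_lt small_colorCodes (R := fun w y => Proper w y ∧ Extends w y)
        ((compP_proper .var0).and (compP_extends .var0))))

/-- A program for the algorithm. -/
theorem exists_prog : ∃ (p : Prog) (C D : ℕ), ∀ w,
    AnswersWithin p w (Accepts w) (C * (budget w + 1) ^ D) := by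
  obtain ⟨p, C, D, hp⟩ := compP_accepts.exists_prog
  refine ⟨p, C, D, fun w => ?_⟩
  obtain ⟨t, m', ht, hr, hv⟩ := hp w
  refine ⟨t, m', ht, hr, ?_⟩
  by_cases h : Accepts w
  · exact .inl ⟨h, by rw [hv, if_pos h]⟩
  · exact .inr ⟨h, by rw [hv, if_neg h]⟩

end

end EqColAlg

/-! ### A Hall condition for colorings of disjoint cliques -/

namespace CliqueColoring

open Finset

open scoped Classical

variable {X Q : Finset ℕ} {cl : ℕ → ℕ} {k : ℕ} {ok : ℕ → ℕ → Prop} {idle : ℕ → ℕ}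

/-- The vertices of the clique `a` that may get one of the colors in `T`. -/
noncomputable def nbr (X : Finset ℕ) (cl : ℕ → ℕ) (ok : ℕ → ℕ → Prop) (a : ℕ) (T : Finset ℕ) :
    Finset ℕ :=
  X.filter fun v => cl v = a ∧ ∃ c ∈ T, ok v c

/-- The largest excess of a subset of `S` over the number of vertices of the clique `a` that may
get one of its colors. -/
noncomputable def deficiency (X : Finset ℕ) (cl : ℕ → ℕ) (ok : ℕ → ℕ → Prop) (S : Finset ℕ)
    (a : ℕ) : ℕ :=
  S.powerset.sup fun T => T.card - (nbr X cl ok a T).card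

/-- A coloring of the disjoint cliques in which color `c` is missing in exactly `idle c` of
them. -/
structure IsColoring (X Q : Finset ℕ) (cl : ℕ → ℕ) (k : ℕ) (ok : ℕ → ℕ → Prop) (idle : ℕ → ℕ)
    (φ : ℕ → ℕ) : Prop where
  lt : ∀ v ∈ X, φ v < k
  ok : ∀ v ∈ X, ok v (φ v)
  inj : ∀ u ∈ X, ∀ v ∈ X, cl u = cl v → φ u = φ v → u = v
  card : ∀ c < k, (X.filter fun v => φ v = c).card + idle c = Q.card

theorem IsColoring.sum_deficiency_le {φ : ℕ → ℕ} (h : IsColoring X Q cl k ok idle φ)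
    (hcl : ∀ v ∈ X, cl v ∈ Q) {S : Finset ℕ} (hS : S ⊆ range k) :
    ∑ a ∈ Q, deficiency X cl ok S a ≤ ∑ c ∈ S, idle c := by
  have h1 : ∀ a ∈ Q, deficiency X cl ok S a ≤
      ∑ c ∈ S, if ∀ v ∈ X, cl v = a → φ v ≠ c then 1 else 0 := by
    intro a _
    rw [← card_filter]
    refine Finset.sup_le fun T hT => ?_
    rw [mem_powerset] at hT
    rw [tsub_le_iff_left]
    calc T.card ≤ ((nbr X cl ok a T).image φ ∪
          S.filter fun c => ∀ v ∈ X, cl v = a → φ v ≠ c).card := by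
          refine card_le_card fun c hc => ?_
          rw [mem_union, mem_image, mem_filter]
          by_cases hu : ∀ v ∈ X, cl v = a → φ v ≠ c
          · exact .inr ⟨hT hc, hu⟩
          · push Not at hu
            obtain ⟨v, hv, hva, hvc⟩ := hu
            exact .inl ⟨v, by
              rw [nbr, mem_filter]
              exact ⟨hv, hva, c, hc, hvc ▸ h.ok v hv⟩, hvc⟩
      _ ≤ _ := (card_union_le _ _).trans (Nat.add_le_add_right card_image_le _)
  refine (sum_le_sum h1).trans ?_
  rw [sum_comm]
  refine sum_le_sum fun c hc => ?_
  have hck := mem_range.1 (hS hc)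
  rw [← card_filter]
  have h2 : ((X.filter fun v => φ v = c).image cl).card = (X.filter fun v => φ v = c).card := by
    refine card_image_of_injOn fun u hu v hv huv => ?_
    simp only [coe_filter, Set.mem_ofPred_eq] at hu hv
    exact h.inj u hu.1 v hv.1 huv (hu.2.trans hv.2.symm)
  have h3 : Disjoint ((X.filter fun v => φ v = c).image cl)
      (Q.filter fun a => ∀ v ∈ X, cl v = a → φ v ≠ c) := by
    rw [disjoint_left]
    intro a ha ha'
    obtain ⟨v, hv, hva⟩ := mem_image.1 ha
    rw [mem_filter] at hv ha'
    exact ha'.2 v hv.1 hva hv.2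
  have h4 : (X.filter fun v => φ v = c).image cl ∪
      (Q.filter fun a => ∀ v ∈ X, cl v = a → φ v ≠ c) ⊆ Q := by
    refine union_subset (fun a ha => ?_) (filter_subset _ _)
    obtain ⟨v, hv, rfl⟩ := mem_image.1 ha
    exact hcl v (mem_filter.1 hv).1
  have h5 := card_le_card h4
  rw [card_union_of_disjoint h3, h2] at h5
  have := h.card c hck
  omega

/-- The places for color `c` at clique `a`: vertices of the clique and idle places. -/
noncomputable def places (X : Finset ℕ) (cl : ℕ → ℕ) (ok : ℕ → ℕ → Prop) (idle : ℕ → ℕ)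
    (x : ℕ × ℕ) : Finset (ℕ ⊕ (Σ _ : ℕ, ℕ)) :=
  (nbr X cl ok x.2 {x.1}).disjSum (({x.1} : Finset ℕ).sigma fun c => range (idle c))

theorem card_le_card_places
    (hall : ∀ S ⊆ range k, ∑ a ∈ Q, deficiency X cl ok S a ≤ ∑ c ∈ S, idle c)
    {s : Finset (ℕ × ℕ)} (hs : s ⊆ range k ×ˢ Q) :
    s.card ≤ (s.biUnion (places X cl ok idle)).card := by
  let T : ℕ → Finset ℕ := fun a => (s.filter fun x => x.2 = a).image Prod.fst
  let S : Finset ℕ := s.image Prod.fst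
  have hTS : ∀ a, T a ⊆ S := fun a => image_subset_image (filter_subset _ _)
  have hSk : S ⊆ range k := fun c hc => by
    obtain ⟨x, hx, rfl⟩ := mem_image.1 hc
    exact (mem_product.1 (hs hx)).1
  have h1 : s.card = ∑ a ∈ Q, (T a).card := by
    rw [card_eq_sum_card_fiberwise (f := Prod.snd) (t := Q)
      (fun x hx => (mem_product.1 (hs hx)).2)]
    refine sum_congr rfl fun a _ => (card_image_of_injOn fun x hx y hy hxy => ?_).symm
    simp only [coe_filter, Set.mem_ofPred_eq] at hx hy
    exact Prod.ext hxy (hx.2.trans hy.2.symm)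
  have h2 : ∑ a ∈ Q, (T a).card ≤
      ∑ a ∈ Q, (nbr X cl ok a (T a)).card + ∑ a ∈ Q, deficiency X cl ok S a := by
    rw [← sum_add_distrib]
    refine sum_le_sum fun a _ => ?_
    have := Finset.le_sup (f := fun T => T.card - (nbr X cl ok a T).card)
      (mem_powerset.2 (hTS a))
    rw [deficiency]
    omega
  have h3 : ((Q.biUnion fun a => nbr X cl ok a (T a)).disjSum (S.sigma fun c => range (idle c)))
      ⊆ s.biUnion (places X cl ok idle) := by
    intro z hz
    rw [mem_biUnion]
    rw [mem_disjSum] at hz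
    rcases hz with ⟨v, hv, rfl⟩ | ⟨⟨c, i⟩, hi, rfl⟩
    · obtain ⟨a, -, hv⟩ := mem_biUnion.1 hv
      rw [nbr, mem_filter] at hv
      obtain ⟨hvX, hva, c, hc, hok⟩ := hv
      obtain ⟨x, hx, rfl⟩ := mem_image.1 hc
      rw [mem_filter] at hx
      refine ⟨x, hx.1, ?_⟩
      rw [places, inl_mem_disjSum, nbr, mem_filter]
      exact ⟨hvX, hva.trans hx.2.symm, x.1, mem_singleton_self _, hok⟩
    · rw [mem_sigma] at hi
      obtain ⟨x, hx, rfl⟩ := mem_image.1 hi.1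
      refine ⟨x, hx, ?_⟩
      rw [places, inr_mem_disjSum, mem_sigma]
      exact ⟨mem_singleton_self _, hi.2⟩
  have h4 := card_le_card h3
  rw [card_disjSum, card_sigma, card_biUnion] at h4
  · simp only [card_range] at h4
    have := hall S hSk
    omega
  · intro a _ b _ hab
    rw [Function.onFun, disjoint_left]
    intro v hv hv'
    rw [nbr, mem_filter] at hv hv'
    exact hab (hv.2.1.symm.trans hv'.2.1)

theorem exists_matching
    (hall : ∀ S ⊆ range k, ∑ a ∈ Q, deficiency X cl ok S a ≤ ∑ c ∈ S, idle c) :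
    ∃ F : ℕ × ℕ → ℕ ⊕ (Σ _ : ℕ, ℕ), (∀ x ∈ range k ×ˢ Q, F x ∈ places X cl ok idle x) ∧
      Set.InjOn F (range k ×ˢ Q : Finset (ℕ × ℕ)) := by
  have h := (Finset.all_card_le_biUnion_card_iff_exists_injective
    (fun x : {x // x ∈ range k ×ˢ Q} => places X cl ok idle x)).1 fun s => by
      have := card_le_card_places hall (s := s.map (Function.Embedding.subtype _)) fun x hx => by
        obtain ⟨y, -, rfl⟩ := mem_map.1 hx
        exact y.2
      rw [card_map] at this
      refine this.trans (le_of_eq (congrArg _ ?_))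
      ext z
      simp
  obtain ⟨f, hinj, hf⟩ := h
  refine ⟨fun x => if hx : x ∈ range k ×ˢ Q then f ⟨x, hx⟩ else .inl 0, fun x hx => ?_, ?_⟩
  · dsimp only
    rw [dif_pos hx]; exact hf ⟨x, hx⟩
  · intro x hx y hy hxy
    rw [mem_coe] at hx hy
    dsimp only at hxy
    rw [dif_pos hx, dif_pos hy] at hxy
    exact congrArg Subtype.val (hinj hxy)

theorem exists_isColoring (hcl : ∀ v ∈ X, cl v ∈ Q)
    (hcard : X.card + ∑ c ∈ range k, idle c = k * Q.card)
    (hall : ∀ S ⊆ range k, ∑ a ∈ Q, deficiency X cl ok S a ≤ ∑ c ∈ S, idle c) :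
    ∃ φ, IsColoring X Q cl k ok idle φ := by
  obtain ⟨F, hF, hinj⟩ := exists_matching hall
  have hinl : ∀ c a v, c < k → a ∈ Q → F (c, a) = .inl v → v ∈ X ∧ cl v = a ∧ ok v c := by
    intro c a v hc ha h
    have := hF (c, a) (mem_product.2 ⟨mem_range.2 hc, ha⟩)
    rw [h, places, inl_mem_disjSum, nbr, mem_filter] at this
    obtain ⟨h1, h2, c', hc', h3⟩ := this
    rw [mem_singleton] at hc'
    subst hc'
    exact ⟨h1, h2, h3⟩
  have hinr : ∀ c a c' i, c < k → a ∈ Q → F (c, a) = .inr ⟨c', i⟩ → c' = c ∧ i < idle c := by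
    intro c a c' i hc ha h
    have := hF (c, a) (mem_product.2 ⟨mem_range.2 hc, ha⟩)
    rw [h, places, inr_mem_disjSum, mem_sigma, mem_singleton, mem_range] at this
    obtain ⟨h1, h2⟩ := this
    dsimp only at h1 h2
    subst h1
    exact ⟨rfl, h2⟩
  have himg : (range k ×ˢ Q).image F = X.disjSum ((range k).sigma fun c => range (idle c)) := by
    refine eq_of_subset_of_card_le (fun z hz => ?_) ?_
    · obtain ⟨⟨c, a⟩, hx, rfl⟩ := mem_image.1 hz
      rw [mem_product, mem_range] at hx
      rcases h : F (c, a) with v | ⟨c', i⟩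
      · rw [inl_mem_disjSum]; exact (hinl c a v hx.1 hx.2 h).1
      · obtain ⟨rfl, hi⟩ := hinr c a c' i hx.1 hx.2 h
        rw [inr_mem_disjSum, mem_sigma, mem_range, mem_range]
        exact ⟨hx.1, hi⟩
    · rw [card_image_of_injOn hinj, card_disjSum, card_sigma, card_product, card_range]
      simp only [card_range]
      exact hcard.le
  have hφ : ∀ v, ∃ c, v ∈ X → c < k ∧ F (c, cl v) = .inl v := by
    intro v
    by_cases hv : v ∈ X
    · have : (.inl v : ℕ ⊕ (Σ _ : ℕ, ℕ)) ∈ (range k ×ˢ Q).image F := by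
        rw [himg, inl_mem_disjSum]; exact hv
      obtain ⟨⟨c, a⟩, hx, h⟩ := mem_image.1 this
      rw [mem_product, mem_range] at hx
      obtain ⟨-, rfl, -⟩ := hinl c a v hx.1 hx.2 h
      exact ⟨c, fun _ => ⟨hx.1, h⟩⟩
    · exact ⟨0, fun h => absurd h hv⟩
  choose φ hφ using hφ
  have hFinj : ∀ c a c' a', c < k → a ∈ Q → c' < k → a' ∈ Q → F (c, a) = F (c', a') →
      c = c' ∧ a = a' := by
    intro c a c' a' hc ha hc' ha' h
    have := hinj (mem_coe.2 (mem_product.2 ⟨mem_range.2 hc, ha⟩))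
      (mem_coe.2 (mem_product.2 ⟨mem_range.2 hc', ha'⟩)) h
    exact ⟨congrArg Prod.fst this, congrArg Prod.snd this⟩
  refine ⟨φ, fun v hv => (hφ v hv).1, fun v hv => ?_, fun u hu v hv h h' => ?_, fun c hc => ?_⟩
  · exact (hinl _ _ v (hφ v hv).1 (hcl v hv) (hφ v hv).2).2.2
  · have h1 := (hφ u hu).2
    rw [h, h', (hφ v hv).2] at h1
    exact (Sum.inl.inj h1).symm
  · have : Q.image (fun a => F (c, a)) = (X.filter fun v => φ v = c).disjSum
        (({c} : Finset ℕ).sigma fun c => range (idle c)) := by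
      ext z
      rw [mem_image]
      constructor
      · rintro ⟨a, ha, rfl⟩
        rcases h : F (c, a) with v | ⟨c', i⟩
        · obtain ⟨hv, rfl, -⟩ := hinl c a v hc ha h
          rw [inl_mem_disjSum, mem_filter]
          exact ⟨hv, (hFinj _ _ _ _ (hφ v hv).1 ha hc ha ((hφ v hv).2.trans h.symm)).1⟩
        · obtain ⟨rfl, hi⟩ := hinr c a c' i hc ha h
          rw [inr_mem_disjSum, mem_sigma, mem_range]
          exact ⟨mem_singleton_self _, hi⟩
      · intro hz
        rw [mem_disjSum] at hz
        rcases hz with ⟨v, hv, rfl⟩ | ⟨⟨c', i⟩, hi, rfl⟩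
        · rw [mem_filter] at hv
          obtain ⟨hv, rfl⟩ := hv
          exact ⟨cl v, hcl v hv, (hφ v hv).2⟩
        · rw [mem_sigma, mem_singleton, mem_range] at hi
          obtain ⟨h1, hi⟩ := hi
          dsimp only at h1 hi
          subst h1
          have : (.inr ⟨c', i⟩ : ℕ ⊕ (Σ _ : ℕ, ℕ)) ∈ (range k ×ˢ Q).image F := by
            rw [himg, inr_mem_disjSum, mem_sigma, mem_range, mem_range]; exact ⟨hc, hi⟩
          obtain ⟨⟨c, a⟩, hx, h⟩ := mem_image.1 this
          rw [mem_product, mem_range] at hx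
          obtain ⟨rfl, -⟩ := hinr c a c' i hx.1 hx.2 h
          exact ⟨a, hx.2, h⟩
    have h2 := congrArg Finset.card this
    rw [card_image_of_injOn, card_disjSum, card_sigma, sum_singleton, card_range] at h2
    · exact h2.symm
    · intro a ha a' ha' h
      exact (hFinj _ _ _ _ hc ha hc ha' h).2

/-! ### Codes for sets of colors -/

/-- The set of colors with code `(s, j)`: those of the first `r` colors given by the binary digits
of `s`, and the next `j` colors. -/
def codeSet (k r s j : ℕ) : Finset ℕ :=
  (range k).filter fun c => (c < r ∧ s / 2 ^ c % 2 = 1) ∨ (r ≤ c ∧ c < r + j)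

/-- Replace the colors from `r` on by the next ones after `r`. -/
def canon (r : ℕ) (S : Finset ℕ) : Finset ℕ :=
  (S.filter fun c => c < r) ∪ Ico r (r + (S.filter fun c => ¬ c < r).card)

theorem sum_two_pow_digit (s : Finset ℕ) (i : ℕ) : (∑ v ∈ s, 2 ^ v) / 2 ^ i % 2 = 1 ↔ i ∈ s := by
  conv_rhs => rw [← Finset.toFinset_bitIndices_sum_two_pow s]
  rw [List.mem_toFinset, Nat.mem_bitIndices, Nat.testBit_eq_decide_div_mod_eq, decide_eq_true_iff]

theorem codeSet_subset_range (k r s j : ℕ) : codeSet k r s j ⊆ range k := filter_subset _ _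

theorem exists_codeSet_eq_canon {k : ℕ} (r : ℕ) {S : Finset ℕ} (hS : S ⊆ range k) :
    ∃ s < 2 ^ r, ∃ j < k + 1, codeSet k r s j = canon r S := by
  have hcard : (S.filter fun c => ¬ c < r).card ≤ k - r := by
    rw [← Nat.card_Ico]
    refine card_le_card fun c hc => ?_
    rw [mem_filter] at hc
    have := mem_range.1 (hS hc.1)
    rw [mem_Ico]
    omega
  refine ⟨∑ c ∈ S.filter fun c => c < r, 2 ^ c,
    Nat.geomSum_lt le_rfl fun c hc => (mem_filter.1 hc).2, (S.filter fun c => ¬ c < r).card,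
    by omega, ?_⟩
  ext c
  simp only [codeSet, canon, mem_filter, mem_union, mem_Ico, sum_two_pow_digit, mem_range]
  constructor
  · rintro ⟨_, ⟨_, h⟩ | h⟩
    · exact .inl h
    · exact .inr h
  · rintro (⟨h, h'⟩ | h)
    · exact ⟨mem_range.1 (hS h), .inl ⟨h', h, h'⟩⟩
    · exact ⟨by omega, .inr h⟩

theorem disjoint_canon (r j : ℕ) (S : Finset ℕ) :
    Disjoint (S.filter fun c => c < r) (Ico r (r + j)) := by
  rw [disjoint_left]
  intro c hc hc'
  rw [mem_filter] at hc
  rw [mem_Ico] at hc'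
  omega

theorem card_canon (r : ℕ) (S : Finset ℕ) : (canon r S).card = S.card := by
  rw [canon, card_union_of_disjoint (disjoint_canon _ _ _), Nat.card_Ico, Nat.add_sub_cancel_left,
    card_filter_add_card_filter_not]

theorem canon_mono {r : ℕ} {S T : Finset ℕ} (h : T ⊆ S) : canon r T ⊆ canon r S :=
  union_subset_union (filter_subset_filter _ h)
    (Ico_subset_Ico_right (Nat.add_le_add_left (card_le_card (filter_subset_filter _ h)) _))

theorem sum_canon {r i₀ : ℕ} (hidle : ∀ c, r ≤ c → idle c = i₀) (S : Finset ℕ) :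
    ∑ c ∈ canon r S, idle c = ∑ c ∈ S, idle c := by
  rw [canon, sum_union (disjoint_canon _ _ _), ← sum_filter_add_sum_filter_not S (fun c => c < r)]
  congr 1
  rw [sum_congr rfl fun c hc => hidle c (mem_Ico.1 hc).1,
    sum_congr rfl fun c hc => hidle c (not_lt.1 (mem_filter.1 hc).2)]
  simp

theorem nbr_canon {r : ℕ} (hok : ∀ v ∈ X, ∀ c, r ≤ c → ok v c) (a : ℕ) (T : Finset ℕ) :
    nbr X cl ok a (canon r T) = nbr X cl ok a T := by
  ext v
  simp only [nbr, mem_filter]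
  refine and_congr_right fun hv => and_congr_right fun _ => ?_
  constructor
  · rintro ⟨c, hc, h⟩
    rw [canon, mem_union, mem_filter, mem_Ico] at hc
    rcases hc with hc | hc
    · exact ⟨c, hc.1, h⟩
    · obtain ⟨d, hd⟩ := card_pos.1 (show 0 < (T.filter fun c => ¬ c < r).card by omega)
      rw [mem_filter] at hd
      exact ⟨d, hd.1, hok v hv d (not_lt.1 hd.2)⟩
  · rintro ⟨c, hc, h⟩
    by_cases hcr : c < r
    · exact ⟨c, mem_union_left _ (mem_filter.2 ⟨hc, hcr⟩), h⟩
    · have : 0 < (T.filter fun c => ¬ c < r).card := card_pos.2 ⟨c, mem_filter.2 ⟨hc, hcr⟩⟩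
      exact ⟨r, mem_union_right _ (mem_Ico.2 ⟨le_rfl, by omega⟩), hok v hv r le_rfl⟩

/-- The deficiency, computed over the subsets with a code only. -/
noncomputable def codeDeficiency (X : Finset ℕ) (cl : ℕ → ℕ) (k r : ℕ) (ok : ℕ → ℕ → Prop)
    (S : Finset ℕ) (a : ℕ) : ℕ :=
  (range (2 ^ r)).sup fun t => (range (k + 1)).sup fun i =>
    if codeSet k r t i ⊆ S then (codeSet k r t i).card - (nbr X cl ok a (codeSet k r t i)).card
    else 0

theorem codeDeficiency_le (r : ℕ) (S : Finset ℕ) (a : ℕ) :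
    codeDeficiency X cl k r ok S a ≤ deficiency X cl ok S a := by
  refine Finset.sup_le fun t _ => Finset.sup_le fun i _ => ?_
  split_ifs with h
  · exact Finset.le_sup (f := fun T => T.card - (nbr X cl ok a T).card) (mem_powerset.2 h)
  · exact Nat.zero_le _

theorem deficiency_le_canon {r : ℕ} (hok : ∀ v ∈ X, ∀ c, r ≤ c → ok v c) {S : Finset ℕ}
    (hS : S ⊆ range k) (a : ℕ) :
    deficiency X cl ok S a ≤ codeDeficiency X cl k r ok (canon r S) a := by
  refine Finset.sup_le fun T hT => ?_
  rw [mem_powerset] at hT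
  obtain ⟨t, ht, i, hi, h⟩ := exists_codeSet_eq_canon r (hT.trans hS)
  have h1 := Finset.le_sup (f := fun t => (range (k + 1)).sup fun i =>
    if codeSet k r t i ⊆ canon r S
    then (codeSet k r t i).card - (nbr X cl ok a (codeSet k r t i)).card else 0)
    (mem_range.2 ht)
  have h2 := Finset.le_sup (f := fun i =>
    if codeSet k r t i ⊆ canon r S
    then (codeSet k r t i).card - (nbr X cl ok a (codeSet k r t i)).card else 0)
    (mem_range.2 hi)
  refine le_trans ?_ (h2.trans h1)
  rw [h, if_pos (canon_mono hT), card_canon, nbr_canon hok]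

theorem hall_iff_codes {r i₀ : ℕ} (hok : ∀ v ∈ X, ∀ c, r ≤ c → ok v c)
    (hidle : ∀ c, r ≤ c → idle c = i₀) :
    (∀ S ⊆ range k, ∑ a ∈ Q, deficiency X cl ok S a ≤ ∑ c ∈ S, idle c) ↔
      ∀ s < 2 ^ r, ∀ j < k + 1, ∑ a ∈ Q, codeDeficiency X cl k r ok (codeSet k r s j) a ≤
        ∑ c ∈ codeSet k r s j, idle c := by
  constructor
  · intro h s _ j _
    exact (sum_le_sum fun a _ => codeDeficiency_le r _ a).trans
      (h _ (codeSet_subset_range k r s j))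
  · intro h S hS
    obtain ⟨s, hs, j, hj, he⟩ := exists_codeSet_eq_canon r hS
    have := h s hs j hj
    rw [he, sum_canon hidle] at this
    exact (sum_le_sum fun a _ => deficiency_le_canon hok hS a).trans this

end CliqueColoring

/-! ### Extending a coloring of a modulator -/

namespace CliqueColoring

open Finset

open scoped Classical

/-- A graph on the vertices `0, …, N - 1` that becomes a cluster graph when the vertices in `M` are
removed. -/
structure IsModulator (N : ℕ) (E : ℕ → ℕ → Prop) (M : ℕ → Prop) : Prop where
  symm : ∀ u v, E u v → E v u
  irrefl : ∀ u, ¬ E u u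
  trans : ∀ a < N, ∀ b < N, ∀ c < N, ¬ M a → ¬ M b → ¬ M c → E a b → E b c → a ≠ c → E a c

variable {N n k m r : ℕ} {E : ℕ → ℕ → Prop} {M : ℕ → Prop} {χ : ℕ → ℕ}

/-- The least vertices of the cliques. -/
def IsRep (N : ℕ) (E : ℕ → ℕ → Prop) (M : ℕ → Prop) (a : ℕ) : Prop :=
  ¬ M a ∧ ∀ u < N, u < a → ¬ M u → ¬ E u a

/-- The least vertex of the clique of `v`. -/
noncomputable def rep (N : ℕ) (E : ℕ → ℕ → Prop) (M : ℕ → Prop) (v : ℕ) : ℕ :=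
  sInf {u | u < N ∧ ¬ M u ∧ (u = v ∨ E u v)}

theorem rep_spec {v : ℕ} (hv : v < N) (hM : ¬ M v) :
    rep N E M v < N ∧ ¬ M (rep N E M v) ∧ (rep N E M v = v ∨ E (rep N E M v) v) :=
  Nat.sInf_mem (s := {u | u < N ∧ ¬ M u ∧ (u = v ∨ E u v)}) ⟨v, hv, hM, .inl rfl⟩

theorem rep_le {u v : ℕ} (hu : u < N) (hM : ¬ M u) (h : u = v ∨ E u v) : rep N E M v ≤ u :=
  Nat.sInf_le (s := {u | u < N ∧ ¬ M u ∧ (u = v ∨ E u v)}) ⟨hu, hM, h⟩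

namespace IsModulator

theorem equiv_trans (h : IsModulator N E M) {a b c : ℕ} (ha : a < N) (hb : b < N) (hc : c < N)
    (hMa : ¬ M a) (hMb : ¬ M b) (hMc : ¬ M c) (hab : a = b ∨ E a b) (hbc : b = c ∨ E b c) :
    a = c ∨ E a c := by
  rcases hab with rfl | hab
  · exact hbc
  · rcases hbc with rfl | hbc
    · exact .inr hab
    · by_cases hac : a = c
      · exact .inl hac
      · exact .inr (h.trans a ha b hb c hc hMa hMb hMc hab hbc hac)

theorem equiv_symm (h : IsModulator N E M) {a b : ℕ} (hab : a = b ∨ E a b) : b = a ∨ E b a :=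
  hab.imp Eq.symm (h.symm a b)

theorem isRep_rep (h : IsModulator N E M) {v : ℕ} (hv : v < N) (hM : ¬ M v) :
    IsRep N E M (rep N E M v) := by
  obtain ⟨h1, h2, h3⟩ := rep_spec (E := E) hv hM
  refine ⟨h2, fun u hu hlt hMu hE => ?_⟩
  have := rep_le hu hMu (h.equiv_trans hu h1 hv hMu h2 hM (.inr hE) h3)
  omega

theorem rep_eq_iff (h : IsModulator N E M) {a v : ℕ} (ha : a < N) (hr : IsRep N E M a)
    (hv : v < N) (hM : ¬ M v) : rep N E M v = a ↔ v = a ∨ E a v := by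
  obtain ⟨h1, h2, h3⟩ := rep_spec (E := E) hv hM
  constructor
  · rintro rfl
    exact h3.imp Eq.symm id
  · intro hav
    have hav' : a = v ∨ E a v := hav.imp Eq.symm id
    refine le_antisymm (rep_le ha hr.1 hav') (not_lt.1 fun hlt => ?_)
    rcases h.equiv_trans h1 hv ha h2 hM hr.1 h3 (h.equiv_symm hav') with h4 | h4
    · omega
    · exact hr.2 _ h1 hlt h2 h4

theorem rep_eq_rep_iff (h : IsModulator N E M) {u v : ℕ} (hu : u < N) (hMu : ¬ M u)
    (hv : v < N) (hMv : ¬ M v) : rep N E M u = rep N E M v ↔ u = v ∨ E u v := by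
  obtain ⟨h1, h2, h3⟩ := rep_spec (E := E) hv hMv
  rw [h.rep_eq_iff h1 (h.isRep_rep hv hMv) hu hMu]
  constructor
  · intro h4
    exact h.equiv_trans hu h1 hv hMu h2 hMv (h.equiv_symm (h4.imp Eq.symm id)) h3
  · intro h4
    exact (h.equiv_trans h1 hv hu h2 hMv hMu h3 (h.equiv_symm h4)).imp Eq.symm id

end IsModulator

/-- The vertices outside of the modulator. -/
noncomputable def rest (N : ℕ) (M : ℕ → Prop) : Finset ℕ := (range N).filter fun v => ¬ M v

/-- The representatives of the cliques. -/
noncomputable def reps (N : ℕ) (E : ℕ → ℕ → Prop) (M : ℕ → Prop) : Finset ℕ :=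
  (range N).filter (IsRep N E M)

/-- Color `c` does not occur among the neighbors of `v` in the modulator. -/
def IsFree (n : ℕ) (E : ℕ → ℕ → Prop) (M : ℕ → Prop) (χ : ℕ → ℕ) (v c : ℕ) : Prop :=
  ∀ u < n, M u → χ u = c → ¬ E u v

/-- The number of times color `c` is used in the modulator. -/
noncomputable def used (n : ℕ) (M : ℕ → Prop) (χ : ℕ → ℕ) (c : ℕ) : ℕ :=
  ((range n).filter fun u => M u ∧ χ u = c).card

/-- A proper coloring with all color classes of size `m`. -/
structure IsExactColoring (N k m : ℕ) (E : ℕ → ℕ → Prop) (ψ : ℕ → ℕ) : Prop where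
  lt : ∀ v < N, ψ v < k
  proper : ∀ u < N, ∀ v < N, E u v → ψ u ≠ ψ v
  card : ∀ c < k, ((range N).filter fun v => ψ v = c).card = m

theorem card_filter_split (hMn : ∀ u, M u → u < n) (hnN : n ≤ N) {ψ : ℕ → ℕ}
    (hψ : ∀ u, M u → ψ u = χ u) (c : ℕ) :
    ((range N).filter fun v => ψ v = c).card =
      ((rest N M).filter fun v => ψ v = c).card + used n M χ c := by
  rw [← card_filter_add_card_filter_not (s := (range N).filter fun v => ψ v = c)
    (fun v => ¬ M v)]
  congr 2
  · ext v
    simp only [rest, mem_filter]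
    tauto
  · ext v
    simp only [mem_filter, mem_range, not_not]
    constructor
    · rintro ⟨⟨_, h1⟩, h2⟩
      exact ⟨hMn v h2, h2, hψ v h2 ▸ h1⟩
    · rintro ⟨h1, h2, h3⟩
      exact ⟨⟨h1.trans_le hnN, (hψ v h2).trans h3⟩, h2⟩

theorem exists_extension_iff (h : IsModulator N E M) (hMn : ∀ u, M u → u < n) (hnN : n ≤ N)
    (hN : N = k * m) (hχk : ∀ u, M u → χ u < k) (hχr : ∀ u, M u → χ u < r)
    (hχ : ∀ u v, M u → M v → E u v → χ u ≠ χ v) :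
    (∃ ψ, IsExactColoring N k m E ψ ∧ ∀ u, M u → ψ u = χ u) ↔
      (∀ c < k, m ≤ (reps N E M).card + used n M χ c) ∧
      ∀ s < 2 ^ r, ∀ j < k + 1,
        ∑ a ∈ reps N E M, codeDeficiency (rest N M) (rep N E M) k r (IsFree n E M χ)
          (codeSet k r s j) a ≤
        ∑ c ∈ codeSet k r s j, ((reps N E M).card + used n M χ c - m) := by
  have hmem : ∀ v, v ∈ rest N M ↔ v < N ∧ ¬ M v := fun v => by rw [rest, mem_filter, mem_range]
  have hcl : ∀ v ∈ rest N M, rep N E M v ∈ reps N E M := fun v hv => by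
    rw [hmem] at hv
    rw [reps, mem_filter, mem_range]
    exact ⟨(rep_spec hv.1 hv.2).1, h.isRep_rep hv.1 hv.2⟩
  have hok : ∀ v ∈ rest N M, ∀ c, r ≤ c → IsFree n E M χ v c := fun v _ c hc u _ hu he => by
    have := hχr u hu
    omega
  have hused : ∀ c, r ≤ c → used n M χ c = 0 := fun c hc => by
    rw [used, card_eq_zero, filter_eq_empty_iff]
    rintro u _ ⟨hu, he⟩
    have := hχr u hu
    omega
  have hidle : ∀ c, r ≤ c → (reps N E M).card + used n M χ c - m = (reps N E M).card - m :=
    fun c hc => by rw [hused c hc, add_zero]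
  rw [← hall_iff_codes (idle := fun c => (reps N E M).card + used n M χ c - m) hok hidle]
  constructor
  · rintro ⟨ψ, hψ, he⟩
    have hinj : ∀ u ∈ rest N M, ∀ v ∈ rest N M, rep N E M u = rep N E M v → ψ u = ψ v →
        u = v := by
      intro u hu v hv huv hc
      rw [hmem] at hu hv
      rw [h.rep_eq_rep_iff hu.1 hu.2 hv.1 hv.2] at huv
      exact huv.resolve_right fun hE => hψ.proper u hu.1 v hv.1 hE hc
    have hle : ∀ c, ((rest N M).filter fun v => ψ v = c).card ≤ (reps N E M).card := by
      intro c
      refine card_le_card_of_injOn (rep N E M) (fun v hv => hcl v (mem_filter.1 hv).1) ?_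
      intro u hu v hv huv
      rw [mem_coe, mem_filter] at hu hv
      exact hinj u hu.1 v hv.1 huv (hu.2.trans hv.2.symm)
    have hsplit := card_filter_split hMn hnN he
    have hm : ∀ c < k, m ≤ (reps N E M).card + used n M χ c := fun c hc => by
      have h1 := hψ.card c hc
      rw [hsplit] at h1
      have := hle c
      omega
    refine ⟨hm, fun S hS => ?_⟩
    refine IsColoring.sum_deficiency_le (k := k) (φ := ψ) ⟨?_, ?_, hinj, ?_⟩ hcl hS
    · exact fun v hv => hψ.lt v ((hmem v).1 hv).1
    · intro v hv u hu hMu hc hE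
      exact hψ.proper u (hu.trans_le hnN) v ((hmem v).1 hv).1 hE ((he u hMu).trans hc)
    · intro c hc
      have h1 := hψ.card c hc
      rw [hsplit] at h1
      have := hle c
      have := hm c hc
      omega
  · rintro ⟨hm, hall⟩
    have hcard : (rest N M).card +
        ∑ c ∈ range k, ((reps N E M).card + used n M χ c - m) = k * (reps N E M).card := by
      have h1 : ∑ c ∈ range k, used n M χ c = ((range n).filter M).card := by
        rw [card_eq_sum_card_fiberwise (f := χ) (t := range k)]
        · refine sum_congr rfl fun c _ => ?_
          rw [used, filter_filter]
        · intro u hu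
          exact mem_coe.2 (mem_range.2 (hχk u (mem_filter.1 hu).2))
      have h2 : (rest N M).card + ((range n).filter M).card = k * m := by
        rw [← hN]
        conv_rhs => rw [← card_range N, ← card_filter_add_card_filter_not (fun v => ¬ M v)]
        congr 2
        ext v
        simp only [mem_filter, mem_range, not_not]
        exact ⟨fun hv => ⟨hv.1.trans_le hnN, hv.2⟩, fun hv => ⟨hMn v hv.2, hv.2⟩⟩
      have h3 : ∑ c ∈ range k, ((reps N E M).card + used n M χ c - m) + k * m =
          k * (reps N E M).card + ∑ c ∈ range k, used n M χ c := by
        calc _ = ∑ c ∈ range k, ((reps N E M).card + used n M χ c - m + m) := by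
              rw [sum_add_distrib]; simp
          _ = ∑ c ∈ range k, ((reps N E M).card + used n M χ c) :=
              sum_congr rfl fun c hc => Nat.sub_add_cancel (hm c (mem_range.1 hc))
          _ = _ := by rw [sum_add_distrib]; simp
      omega
    obtain ⟨φ, hφ⟩ := exists_isColoring hcl hcard hall
    let ψ : ℕ → ℕ := fun v => if M v then χ v else φ v
    have hψM : ∀ u, M u → ψ u = χ u := fun u hu => if_pos hu
    have hψX : ∀ u, ¬ M u → ψ u = φ u := fun u hu => if_neg hu
    refine ⟨ψ, ⟨fun v hv => ?_, fun u hu v hv hE => ?_, fun c hc => ?_⟩, hψM⟩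
    · by_cases hM : M v
      · rw [hψM v hM]; exact hχk v hM
      · rw [hψX v hM]; exact hφ.lt v ((hmem v).2 ⟨hv, hM⟩)
    · by_cases hMu : M u <;> by_cases hMv : M v
      · rw [hψM u hMu, hψM v hMv]; exact hχ u v hMu hMv hE
      · rw [hψM u hMu, hψX v hMv]
        intro hc
        exact hφ.ok v ((hmem v).2 ⟨hv, hMv⟩) u (hMn u hMu) hMu hc hE
      · rw [hψX u hMu, hψM v hMv]
        intro hc
        exact hφ.ok u ((hmem u).2 ⟨hu, hMu⟩) v (hMn v hMv) hMv hc.symm (h.symm u v hE)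
      · rw [hψX u hMu, hψX v hMv]
        intro hc
        have := hφ.inj u ((hmem u).2 ⟨hu, hMu⟩) v ((hmem v).2 ⟨hv, hMv⟩)
          ((h.rep_eq_rep_iff hu hMu hv hMv).2 (.inr hE)) hc
        exact h.irrefl u (this ▸ hE)
    · rw [card_filter_split hMn hnN hψM]
      have h1 : (rest N M).filter (fun v => ψ v = c) = (rest N M).filter fun v => φ v = c :=
        filter_congr fun v hv => by rw [hψX v ((hmem v).1 hv).2]
      have := hφ.card c hc
      have := hm c hc
      rw [h1]
      omega

end CliqueColoring

/-! ### Padding -/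

namespace CliqueColoring

open Finset

open scoped Classical

/-- An equitable coloring of a graph with the vertices `0, …, n - 1`. -/
structure IsEquitable (n k : ℕ) (A : ℕ → ℕ → Prop) (φ : ℕ → ℕ) : Prop where
  lt : ∀ v < n, φ v < k
  proper : ∀ u < n, ∀ v < n, A u v → φ u ≠ φ v
  le_card : ∀ c < k, n / k ≤ ((range n).filter fun v => φ v = c).card
  card_le : ∀ c < k, ((range n).filter fun v => φ v = c).card ≤ n ⌈/⌉ k

/-- The graph together with a clique on the vertices from `n` on. -/
def padded (n : ℕ) (A : ℕ → ℕ → Prop) (u v : ℕ) : Prop :=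
  (u < n ∧ v < n ∧ A u v) ∨ (n ≤ u ∧ n ≤ v ∧ u ≠ v)

theorem card_filter_range_add (a b : ℕ) (P : ℕ → Prop) [DecidablePred P] :
    ((range (a + b)).filter P).card =
      ((range a).filter P).card + ((range b).filter fun i => P (a + i)).card := by
  rw [card_filter, card_filter, card_filter, sum_range_add]

theorem le_mul_ceilDiv {n k : ℕ} (hk : 0 < k) : n ≤ k * (n ⌈/⌉ k) := by
  have := le_smul_ceilDiv (a := k) (b := n) hk
  simpa using this

theorem mul_ceilDiv_lt {n k : ℕ} (hk : 0 < k) : k * (n ⌈/⌉ k) < n + k := by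
  rw [Nat.ceilDiv_eq_add_pred_div]
  have := Nat.mul_div_le (n + k - 1) k
  omega

theorem IsEquitable.exists_isExactColoring {n k : ℕ} {A : ℕ → ℕ → Prop} {φ : ℕ → ℕ} (hk : 0 < k)
    (h : IsEquitable n k A φ) :
    ∃ ψ, IsExactColoring (k * (n ⌈/⌉ k)) k (n ⌈/⌉ k) (padded n A) ψ := by
  set m := n ⌈/⌉ k with hm
  have h1 : n ≤ k * m := le_mul_ceilDiv hk
  have h2 : k * m < n + k := mul_ceilDiv_lt hk
  have h3 : m ≤ n / k + 1 := by
    have h4 : n < k * (n / k + 1) := by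
      exact Nat.lt_mul_div_succ n hk
    by_contra hlt
    have : k * (n / k + 1 + 1) ≤ k * m := Nat.mul_le_mul_left _ (by omega)
    rw [mul_add] at this
    omega
  set x : ℕ → ℕ := fun c => ((range n).filter fun v => φ v = c).card with hx
  have hxle : ∀ c < k, x c ≤ m := h.card_le
  have hxge : ∀ c < k, n / k ≤ x c := h.le_card
  set D := (range k).filter fun c => x c < m with hD
  have hsum : ∑ c ∈ range k, x c = n := by
    conv_rhs => rw [← card_range n]
    exact (card_eq_sum_card_fiberwise fun v hv => by
      exact mem_coe.2 (mem_range.2 (h.lt v (mem_range.1 (mem_coe.1 hv))))).symm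
  have hcard : D.card = k * m - n := by
    have : ∑ c ∈ range k, (x c + if x c < m then 1 else 0) = ∑ c ∈ range k, m := by
      refine sum_congr rfl fun c hc => ?_
      have h4 := hxge c (mem_range.1 hc)
      have h5 := hxle c (mem_range.1 hc)
      split_ifs <;> omega
    rw [sum_add_distrib, hsum, ← card_filter, ← hD, sum_const, card_range, smul_eq_mul] at this
    omega
  obtain ⟨p, hp⟩ : ∃ p, k * m = n + p := ⟨k * m - n, by omega⟩
  have hDp : D.card = p := by omega
  let e := (equivFinOfCardEq hDp).symm
  let ψ : ℕ → ℕ := fun v => if v < n then φ v else if hv : v - n < p then e ⟨v - n, hv⟩ else 0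
  have hψ1 : ∀ v < n, ψ v = φ v := fun v hv => if_pos hv
  have hψ2 : ∀ i (hi : i < p), ψ (n + i) = e ⟨i, hi⟩ := fun i hi => by
    have h5 : ¬ n + i < n := by omega
    simp only [ψ, if_neg h5, Nat.add_sub_cancel_left, dif_pos hi]
  rw [hp]
  refine ⟨ψ, fun v hv => ?_, fun u hu v hv hE => ?_, fun c hc => ?_⟩
  · by_cases hvn : v < n
    · rw [hψ1 v hvn]; exact h.lt v hvn
    · obtain ⟨i, rfl⟩ : ∃ i, v = n + i := ⟨v - n, by omega⟩
      rw [hψ2 i (by omega)]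
      exact mem_range.1 (mem_filter.1 (e _).2).1
  · rcases hE with ⟨hun, hvn, hA⟩ | ⟨hun, hvn, hne⟩
    · rw [hψ1 u hun, hψ1 v hvn]; exact h.proper u hun v hvn hA
    · obtain ⟨i, rfl⟩ : ∃ i, u = n + i := ⟨u - n, by omega⟩
      obtain ⟨j, rfl⟩ : ∃ j, v = n + j := ⟨v - n, by omega⟩
      rw [hψ2 i (by omega), hψ2 j (by omega)]
      intro heq
      have := congrArg Fin.val (e.injective (Subtype.ext heq))
      exact hne (congrArg _ this)
  · rw [card_filter_range_add]
    have h4 : ((range n).filter fun v => ψ v = c) = (range n).filter fun v => φ v = c :=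
      filter_congr fun v hv => by rw [hψ1 v (mem_range.1 hv)]
    rw [h4]
    have h6 := hxge c hc
    have h7 := hxle c hc
    simp only [hx] at h6 h7
    by_cases hcD : c ∈ D
    · have h5 : ((range p).filter fun i => ψ (n + i) = c) = {(e.symm ⟨c, hcD⟩ : ℕ)} := by
        ext i
        rw [mem_filter, mem_range, mem_singleton]
        constructor
        · rintro ⟨hi, hc'⟩
          rw [hψ2 i hi] at hc'
          have : e ⟨i, hi⟩ = ⟨c, hcD⟩ := Subtype.ext hc'
          rw [← this, Equiv.symm_apply_apply]
        · rintro rfl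
          refine ⟨(e.symm ⟨c, hcD⟩).2, ?_⟩
          rw [hψ2 _ (e.symm ⟨c, hcD⟩).2, Fin.eta, Equiv.apply_symm_apply]
      rw [h5, card_singleton]
      have : x c < m := (mem_filter.1 hcD).2
      simp only [hx] at this
      omega
    · have h5 : ((range p).filter fun i => ψ (n + i) = c) = ∅ := by
        rw [filter_eq_empty_iff]
        intro i hi hc'
        rw [hψ2 i (mem_range.1 hi)] at hc'
        exact hcD (hc' ▸ (e _).2)
      rw [h5, card_empty]
      have : ¬ x c < m := fun hlt => hcD (mem_filter.2 ⟨mem_range.2 hc, hlt⟩)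
      simp only [hx] at this
      omega

theorem IsExactColoring.isEquitable {n k : ℕ} {A : ℕ → ℕ → Prop} {ψ : ℕ → ℕ} (hk : 0 < k)
    (h : IsExactColoring (k * (n ⌈/⌉ k)) k (n ⌈/⌉ k) (padded n A) ψ) : IsEquitable n k A ψ := by
  set m := n ⌈/⌉ k with hm
  have h1 : n ≤ k * m := le_mul_ceilDiv hk
  have h2 : k * m < n + k := mul_ceilDiv_lt hk
  obtain ⟨p, hp⟩ : ∃ p, k * m = n + p := ⟨k * m - n, by omega⟩
  rw [hp] at h
  have hcard : ∀ c < k, ((range n).filter fun v => ψ v = c).card +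
      ((range p).filter fun i => ψ (n + i) = c).card = m := fun c hc => by
    rw [← card_filter_range_add]; exact h.card c hc
  refine ⟨fun v hv => h.lt v (by omega), fun u hu v hv hA => ?_, fun c hc => ?_, fun c hc => ?_⟩
  · exact h.proper u (by omega) v (by omega) (.inl ⟨hu, hv, hA⟩)
  · have h3 := hcard c hc
    have h4 : ((range p).filter fun i => ψ (n + i) = c).card ≤ 1 := by
      rw [card_le_one]
      intro i hi j hj
      rw [mem_filter, mem_range] at hi hj
      by_contra hne
      exact h.proper (n + i) (by omega) (n + j) (by omega)
        (.inr ⟨by omega, by omega, by omega⟩) (hi.2.trans hj.2.symm)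
    have h5 : k * (n / k) ≤ n := Nat.mul_div_le n k
    rcases Nat.eq_zero_or_pos p with rfl | hpos
    · have h6 : m = n / k := by
        rw [add_zero] at hp
        rw [← hp, Nat.mul_div_cancel_left _ hk]
      rw [range_zero, filter_empty, card_empty] at h3
      omega
    · have h6 : n / k < m := by
        by_contra hlt
        have : k * m ≤ k * (n / k) := Nat.mul_le_mul_left _ (by omega)
        omega
      omega
  · have := hcard c hc
    omega

/-! ### Permuting the colors and coding colorings -/

theorem exists_perm_image_lt {k r : ℕ} {I : Finset ℕ} (hI : I ⊆ range k) (hr : I.card ≤ r) :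
    ∃ π : ℕ → ℕ, (∀ c < k, π c < k) ∧ (∀ c < k, ∀ d < k, π c = π d → c = d) ∧
      (∀ c < k, ∃ d < k, ∀ b < k, π b = c ↔ b = d) ∧ ∀ c ∈ I, π c < r := by
  have hIk : I.card ≤ k := by simpa using card_le_card hI
  have hcard : Fintype.card {x : Fin k // (x : ℕ) ∈ I} =
      Fintype.card {x : Fin k // (x : ℕ) < I.card} := by
    have h1 : Fintype.card {x : Fin k // (x : ℕ) ∈ I} = I.card := by
      rw [← Fintype.card_coe]
      exact Fintype.card_congr ⟨fun x => ⟨x.1, x.2⟩,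
        fun x => ⟨⟨x.1, mem_range.1 (hI x.2)⟩, x.2⟩, fun _ => rfl, fun _ => rfl⟩
    have h2 : Fintype.card {x : Fin k // (x : ℕ) < I.card} = I.card := by
      conv_rhs => rw [← Fintype.card_fin I.card]
      exact Fintype.card_congr ⟨fun x => ⟨x.1, x.2⟩,
        fun x => ⟨⟨x.1, x.2.trans_le hIk⟩, x.2⟩, fun _ => rfl, fun _ => rfl⟩
    rw [h1, h2]
  let σ : Equiv.Perm (Fin k) := (Fintype.equivOfCardEq hcard).extendSubtype
  have hσ : ∀ c (hc : c < k), (if h : c < k then (σ ⟨c, h⟩ : ℕ) else c) = σ ⟨c, hc⟩ :=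
    fun c hc => dif_pos hc
  refine ⟨fun c => if h : c < k then (σ ⟨c, h⟩ : ℕ) else c, fun c hc => ?_, fun c hc d hd h => ?_,
    fun c hc => ⟨σ.symm ⟨c, hc⟩, (σ.symm ⟨c, hc⟩).2, fun b hb => ?_⟩, fun c hc => ?_⟩
  · dsimp only; rw [hσ c hc]; exact (σ _).2
  · dsimp only at h
    rw [hσ c hc, hσ d hd] at h
    exact congrArg Fin.val (σ.injective (Fin.ext h))
  · dsimp only
    rw [hσ b hb]
    constructor
    · intro h
      have : σ ⟨b, hb⟩ = ⟨c, hc⟩ := Fin.ext h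
      rw [← this, Equiv.symm_apply_apply]
    · rintro rfl
      rw [Fin.eta, Equiv.apply_symm_apply]
  · have hck := mem_range.1 (hI hc)
    dsimp only
    rw [hσ c hck]
    have := Equiv.extendSubtype_mem (Fintype.equivOfCardEq hcard) ⟨c, hck⟩ hc
    exact this.trans_le hr

theorem IsExactColoring.exists_lt {N k m r : ℕ} {E : ℕ → ℕ → Prop} {ψ : ℕ → ℕ} {U : Finset ℕ}
    (h : IsExactColoring N k m E ψ) (hU : U ⊆ range N) (hr : U.card ≤ r) :
    ∃ ψ', IsExactColoring N k m E ψ' ∧ ∀ u ∈ U, ψ' u < r := by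
  obtain ⟨π, h1, h2, h3, h4⟩ := exists_perm_image_lt (k := k) (r := r) (I := U.image ψ)
    (fun c hc => by
      obtain ⟨u, hu, rfl⟩ := mem_image.1 hc
      exact mem_range.2 (h.lt u (mem_range.1 (hU hu))))
    (card_image_le.trans hr)
  refine ⟨fun v => π (ψ v), ⟨fun v hv => h1 _ (h.lt v hv), fun u hu v hv hE he => ?_,
    fun c hc => ?_⟩, fun u hu => h4 _ (mem_image_of_mem _ hu)⟩
  · exact h.proper u hu v hv hE (h2 _ (h.lt u hu) _ (h.lt v hv) he)
  · obtain ⟨d, hd, hb⟩ := h3 c hc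
    rw [← h.card d hd]
    exact congrArg Finset.card (filter_congr fun v hv => hb _ (h.lt v (mem_range.1 hv)))

theorem exists_digits_eq {b l : ℕ} {f : ℕ → ℕ} (hf : ∀ i < l, f i < b) :
    ∃ y < b ^ l, ∀ i < l, y / b ^ i % b = f i := by
  let y := finFunctionFinEquiv (fun i : Fin l => (⟨f i, hf i i.2⟩ : Fin b))
  refine ⟨y, y.2, fun i hi => ?_⟩
  have h1 : finFunctionFinEquiv.symm y ⟨i, hi⟩ = ⟨f i, hf i hi⟩ := by
    rw [Equiv.symm_apply_apply]
  have h2 := congrArg Fin.val h1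
  rwa [finFunctionFinEquiv_symm_apply_val] at h2

/-- The number of elements of `M` below `v`. -/
noncomputable def rankIn (n : ℕ) (M : ℕ → Prop) (v : ℕ) : ℕ :=
  ((range n).filter fun u => u < v ∧ M u).card

theorem rankIn_lt_card {n v : ℕ} {M : ℕ → Prop} (hv : v < n) (hM : M v) :
    rankIn n M v < ((range n).filter M).card := by
  refine card_lt_card ⟨fun u hu => ?_, fun h => ?_⟩
  · rw [mem_filter] at hu ⊢
    exact ⟨hu.1, hu.2.2⟩
  · have := h (mem_filter.2 ⟨mem_range.2 hv, hM⟩)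
    rw [mem_filter] at this
    omega

theorem rankIn_strictMono {n u v : ℕ} {M : ℕ → Prop} (hu : u < n) (hM : M u) (huv : u < v) :
    rankIn n M u < rankIn n M v := by
  refine card_lt_card ⟨fun x hx => ?_, fun h => ?_⟩
  · rw [mem_filter] at hx ⊢
    exact ⟨hx.1, by omega, hx.2.2⟩
  · have := h (mem_filter.2 ⟨mem_range.2 hu, huv, hM⟩)
    rw [mem_filter] at this
    omega

theorem exists_code {n r : ℕ} {M : ℕ → Prop} (hMn : ∀ u, M u → u < n)
    (hr : ((range n).filter M).card = r) {ψ : ℕ → ℕ} (hψ : ∀ u, M u → ψ u < r) :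
    ∃ y < r ^ r, ∀ u, M u → y / r ^ rankIn n M u % r = ψ u := by
  have hinj : ∀ u v, M u → M v → rankIn n M u = rankIn n M v → u = v := by
    intro u v hu hv h
    rcases lt_trichotomy u v with hlt | heq | hlt
    · have := rankIn_strictMono (hMn u hu) hu hlt; omega
    · exact heq
    · have := rankIn_strictMono (hMn v hv) hv hlt; omega
  obtain ⟨y, hy, h⟩ := exists_digits_eq (b := r) (l := r)
    (f := fun i => if h : ∃ u, M u ∧ rankIn n M u = i then ψ h.choose else 0) (fun i hi => by
      split_ifs with h
      · exact hψ _ h.choose_spec.1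
      · omega)
  refine ⟨y, hy, fun u hu => ?_⟩
  rw [h _ (hr ▸ rankIn_lt_card (hMn u hu) hu)]
  have hex : ∃ v, M v ∧ rankIn n M v = rankIn n M u := ⟨u, hu, rfl⟩
  rw [dif_pos hex, hinj _ _ hex.choose_spec.1 hu hex.choose_spec.2]

/-- The coloring of `M` with code `y`. -/
noncomputable def decode (n r : ℕ) (M : ℕ → Prop) (y u : ℕ) : ℕ := y / r ^ rankIn n M u % r

theorem isModulator_padded {N n : ℕ} {A : ℕ → ℕ → Prop} {M : ℕ → Prop}
    (hsymm : ∀ u < n, ∀ v < n, A u v → A v u) (hirr : ∀ u < n, ¬ A u u)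
    (htrans : ∀ a < n, ∀ b < n, ∀ c < n, ¬ M a → ¬ M b → ¬ M c → A a b → A b c → a ≠ c → A a c) :
    IsModulator N (padded n A) M := by
  refine ⟨?_, ?_, ?_⟩
  · rintro u v (⟨hu, hv, h⟩ | ⟨hu, hv, h⟩)
    · exact .inl ⟨hv, hu, hsymm u hu v hv h⟩
    · exact .inr ⟨hv, hu, h.symm⟩
  · rintro u (⟨hu, -, h⟩ | ⟨-, -, h⟩)
    · exact hirr u hu h
    · exact h rfl
  · rintro a - b - c - ha hb hc (⟨h1, h2, h3⟩ | ⟨h1, h2, h3⟩) (⟨h4, h5, h6⟩ | ⟨h4, h5, h6⟩) hac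
    · exact .inl ⟨h1, h5, htrans a h1 b h2 c h5 ha hb hc h3 h6 hac⟩
    · omega
    · omega
    · exact .inr ⟨h1, h5, hac⟩

theorem exists_isEquitable_iff {n k r : ℕ} {A : ℕ → ℕ → Prop} {M : ℕ → Prop} (hk : 0 < k)
    (hMn : ∀ u, M u → u < n) (hr : ((range n).filter M).card = r) :
    (∃ φ, IsEquitable n k A φ) ↔ ∃ y < r ^ r,
      (∀ u, M u → decode n r M y u < k ∧
        ∀ v, M v → A u v → decode n r M y u ≠ decode n r M y v) ∧
      ∃ ψ, IsExactColoring (k * (n ⌈/⌉ k)) k (n ⌈/⌉ k) (padded n A) ψ ∧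
        ∀ u, M u → ψ u = decode n r M y u := by
  have hle : n ≤ k * (n ⌈/⌉ k) := le_mul_ceilDiv hk
  constructor
  · rintro ⟨φ, hφ⟩
    obtain ⟨ψ, hψ⟩ := hφ.exists_isExactColoring hk
    obtain ⟨ψ', hψ', hlt⟩ := hψ.exists_lt (U := (range n).filter M) (r := r)
      ((filter_subset _ _).trans (range_subset_range.2 hle)) hr.le
    obtain ⟨y, hy, he⟩ := exists_code hMn hr
      (ψ := ψ') fun u hu => hlt u (mem_filter.2 ⟨mem_range.2 (hMn u hu), hu⟩)
    refine ⟨y, hy, fun u hu => ?_, ψ', hψ', fun u hu => (he u hu).symm⟩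
    have hun := hMn u hu
    refine ⟨by rw [decode, he u hu]; exact hψ'.lt u (by omega), fun v hv hA => ?_⟩
    have hvn := hMn v hv
    rw [decode, decode, he u hu, he v hv]
    exact hψ'.proper u (by omega) v (by omega) (.inl ⟨hun, hvn, hA⟩)
  · rintro ⟨y, _, _, ψ, hψ, _⟩
    exact ⟨ψ, hψ.isEquitable hk⟩

end CliqueColoring

/-! ### Correctness of the algorithm -/

namespace EqColAlg

open Finset RAM CliqueColoring

open scoped Classical

/-! The input word. -/

theorem getD_flatMap {ι : Type*} {n : ℕ} (f : ι → List Bool) (hf : ∀ i, (f i).length = n)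
    (l : List ι) (u v : ℕ) (hu : u < l.length) (hv : v < n) (d : Bool) :
    (l.flatMap f).getD (n * u + v) d = (f l[u]).getD v d := by
  induction l generalizing u with
  | nil => simp at hu
  | cons a l ih =>
    rw [List.flatMap_cons]
    cases u with
    | zero => rw [List.getD_append _ _ _ _ (by rw [hf]; omega)]; simp
    | succ u =>
      rw [List.getD_append_right _ _ _ _ (by rw [hf, mul_add]; omega), hf,
        show n * (u + 1) + v - n = n * u + v by rw [mul_add]; omega]
      rw [ih u (by simpa using hu)]
      simp

theorem sum_bits (k m : ℕ) (hm : k.bits.length ≤ m) :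
    (∑ i ∈ range m, if k.bits.getD i false = true then 2 ^ i else 0) = k := by
  rw [← sum_filter]
  conv_rhs => rw [← Finset.sum_toFinset_bitIndices_two_pow k]
  refine sum_congr ?_ fun _ _ => rfl
  ext i
  rw [mem_filter, mem_range, List.mem_toFinset, Nat.mem_bitIndices, Nat.testBit_eq_inth,
    ← List.getD_default_eq_getI]
  refine ⟨fun h => h.2, fun h => ⟨?_, h⟩⟩
  by_contra hlt
  rw [List.getD_eq_default _ _ (by omega)] at h
  exact absurd h (by decide)

variable (x : EqColInstance)

theorem length_encode : x.encode.length = x.n + 1 + x.n * x.n + x.k.bits.length := by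
  simp [EqColInstance.encode, EqColInstance.length_adjBits]; omega

theorem getD_encode_lt {i : ℕ} (hi : i < x.n) : x.encode.getD i false = true := by
  rw [EqColInstance.encode, List.getD_append _ _ _ _ (by simpa using hi)]
  simp [List.getD_eq_getElem?_getD, hi]

theorem getD_encode_self : x.encode.getD x.n false = false := by
  rw [EqColInstance.encode, List.getD_append_right _ _ _ _ (by simp)]
  simp

theorem getD_encode_add (i : ℕ) : x.encode.getD (x.n + 1 + i) false =
    (EqColInstance.adjBits x.G ++ x.k.bits).getD i false := by
  rw [EqColInstance.encode, List.getD_append_right _ _ _ _ (by simp; omega),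
    List.length_replicate, show x.n + 1 + i - x.n = i + 1 by omega, List.getD_cons_succ]

theorem order_encode : order x.encode = x.n := by
  have key : ∀ j : ℕ, (Nat.rec (motive := fun _ => ℕ) 0
      (fun _ acc => if Bit x.encode acc then acc + 1 else acc) j : ℕ) = min j x.n := by
    intro j
    induction j with
    | zero => simp
    | succ j ih =>
      dsimp only
      rw [ih]
      by_cases hj : j < x.n
      · rw [min_eq_left hj.le, if_pos (show Bit x.encode j from getD_encode_lt x hj),
          min_eq_left hj]
      · rw [min_eq_right (not_lt.1 hj), if_neg, min_eq_right (by omega)]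
        rw [Bit, getD_encode_self]; decide
  rw [order, key, min_eq_right]
  rw [length_encode]; omega

theorem adj_encode {u v : ℕ} (hu : u < x.n) (hv : v < x.n) :
    Adj x.encode u v ↔ x.G.Adj ⟨u, hu⟩ ⟨v, hv⟩ := by
  rw [Adj, Bit, order_encode, getD_encode_add, List.getD_append, EqColInstance.adjBits,
    getD_flatMap (n := x.n) _ (by simp) _ _ _ (by simpa using hu) hv]
  · simp [List.getD_eq_getElem?_getD, hv]
  · rw [EqColInstance.length_adjBits]
    nlinarith

theorem le_width : x.n ≤ width x.encode := by rw [width, length_encode]; omega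

theorem mul_self_le_width : x.n * x.n ≤ width x.encode := by rw [width, length_encode]; omega

theorem three_le_width : 3 ≤ width x.encode := by rw [width, length_encode]; omega

theorem three_mul_le_width : 3 * x.n ≤ width x.encode := by rw [width, length_encode]; omega

theorem powW_two {i : ℕ} (hi : i ≤ width x.encode) : powW x.encode 2 i = 2 ^ i := by
  have := three_le_width x
  rw [powW, min_eq_left hi, min_eq_left (by omega)]

theorem colors_encode : colors x.encode = x.k := by
  rw [colors]
  conv_rhs => rw [← sum_bits x.k x.encode.length (by rw [length_encode]; omega)]
  refine sum_congr rfl fun i hi => ?_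
  rw [mem_range] at hi
  rw [powW_two x (by rw [width]; omega), Bit, order_encode, add_assoc (x.n + 1),
    getD_encode_add, List.getD_append_right _ _ _ _
      (by rw [EqColInstance.length_adjBits]; omega), EqColInstance.length_adjBits,
    Nat.add_sub_cancel_left]
  congr

theorem adj_symm : ∀ u < x.n, ∀ v < x.n, Adj x.encode u v → Adj x.encode v u := by
  intro u hu v hv h
  rw [adj_encode x hu hv] at h
  rw [adj_encode x hv hu]
  exact h.symm

theorem adj_irrefl : ∀ u < x.n, ¬ Adj x.encode u u := by
  intro u hu h
  rw [adj_encode x hu hu] at h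
  exact h.ne rfl

/-! The modulator. -/

theorem digit_triple {t i : ℕ} (ht : t < x.n ^ 3) (hi : i < 3) :
    digitW x.encode (order x.encode) t i = t / x.n ^ i % x.n := by
  have hn : 0 < x.n := by
    by_contra h
    rw [Nat.eq_zero_of_not_pos h] at ht
    simp at ht
  rw [order_encode]
  refine digitW_eq hn (le_width x) (hi.trans_le (three_le_width x)) ?_
  calc t < x.n ^ 3 := ht
    _ ≤ (2 ^ x.n) ^ 3 := Nat.pow_le_pow_left Nat.lt_two_pow_self.le 3
    _ = 2 ^ (3 * x.n) := by rw [← pow_mul, mul_comm]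
    _ ≤ _ := Nat.pow_le_pow_right (by norm_num) (three_mul_le_width x)

theorem digit_mask {U : Finset ℕ} (hU : U ⊆ range x.n) {v : ℕ} (hv : v < x.n) :
    digitW x.encode 2 (∑ u ∈ U, 2 ^ u) v = if v ∈ U then 1 else 0 := by
  have h3 := three_le_width x
  have hw := le_width x
  rw [digitW_eq (by norm_num) (by omega) (by omega)]
  · by_cases h : v ∈ U
    · rw [if_pos h, (sum_two_pow_digit U v).2 h]
    · rw [if_neg h]
      have := mt (sum_two_pow_digit U v).1 h
      omega
  · exact (Nat.geomSum_lt le_rfl fun u hu => mem_range.1 (hU hu)).trans_le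
      (Nat.pow_le_pow_right (by norm_num) hw)

/-- The set `W` meets all induced paths on three vertices. -/
def HitsPaths (n : ℕ) (A : ℕ → ℕ → Prop) (W : Finset ℕ) : Prop :=
  ∀ a < n, ∀ b < n, ∀ c < n, A a b → A b c → ¬ A a c → a ≠ c → a ∈ W ∨ b ∈ W ∨ c ∈ W

theorem exists_greedy (t : ℕ) (ht : t ≤ x.n ^ 3) :
    ∃ U ⊆ range x.n,
      (Nat.rec (motive := fun _ => ℕ) 0 (maskStep x.encode) t : ℕ) = ∑ u ∈ U, 2 ^ u ∧
      (∀ W, HitsPaths x.n (Adj x.encode) W → U.card ≤ 3 * (U ∩ W).card) ∧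
      ∀ t' < t, IsPath x.encode t' →
        ∃ i < 3, digitW x.encode (order x.encode) t' i ∈ U := by
  induction t with
  | zero => exact ⟨∅, by simp, by simp, by simp, by simp⟩
  | succ t ih =>
    obtain ⟨U, hU, hmask, hcard, hhit⟩ := ih (by omega)
    have hn : 0 < x.n := by
      by_contra h
      rw [Nat.eq_zero_of_not_pos h] at ht
      simp at ht
    let d : ℕ → ℕ := digitW x.encode (order x.encode) t
    have hd : ∀ i < 3, d i < x.n := fun i hi => by
      simp only [d]
      rw [digit_triple x (by omega) hi]
      exact Nat.mod_lt _ hn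
    have hav : Avoids x.encode t (∑ u ∈ U, 2 ^ u) ↔ ∀ i < 3, d i ∉ U := by
      refine forall₂_congr fun i hi => ?_
      have := digit_mask x hU (hd i hi)
      simp only [d] at this ⊢
      rw [this]
      simp
    dsimp only
    rw [hmask, maskStep, hav]
    by_cases hc : IsPath x.encode t ∧ ∀ i < 3, d i ∉ U
    · rw [if_pos hc]
      obtain ⟨⟨h01, h12, h02, hne⟩, hnU⟩ := hc
      have h0 := hd 0 (by norm_num)
      have h1 := hd 1 (by norm_num)
      have h2 := hd 2 (by norm_num)
      have hne01 : d 0 ≠ d 1 := fun h => adj_irrefl x (d 1) h1 (by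
        have h01' : Adj x.encode (d 0) (d 1) := h01
        rwa [h] at h01')
      have hne12 : d 1 ≠ d 2 := fun h => adj_irrefl x (d 2) h2 (by
        have h12' : Adj x.encode (d 1) (d 2) := h12
        rwa [h] at h12')
      have hinj : Set.InjOn d (range 3 : Finset ℕ) := by
        have hne02 : d 0 ≠ d 2 := hne
        intro i hi j hj hij
        rw [mem_coe, mem_range] at hi hj
        interval_cases i <;> interval_cases j <;> simp_all
      have hdisj : Disjoint U ((range 3).image d) := by
        rw [disjoint_left]
        intro u hu hu'
        obtain ⟨i, hi, rfl⟩ := mem_image.1 hu'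
        exact hnU i (mem_range.1 hi) hu
      refine ⟨U ∪ (range 3).image d, ?_, ?_, fun W hW => ?_, fun t' ht' hp => ?_⟩
      · refine union_subset hU fun u hu => ?_
        obtain ⟨i, hi, rfl⟩ := mem_image.1 hu
        exact mem_range.2 (hd i (mem_range.1 hi))
      · rw [sum_union hdisj, sum_image hinj]
        congr 1
        refine sum_congr rfl fun i hi => powW_two x ?_
        exact (hd i (mem_range.1 hi)).le.trans (le_width x)
      · rw [card_union_of_disjoint hdisj, card_image_of_injOn hinj, card_range,
          union_inter_distrib_right, card_union_of_disjoint
            (hdisj.mono inter_subset_left inter_subset_left)]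
        have h3 : 0 < ((range 3).image d ∩ W).card := by
          rw [card_pos]
          have hi : ∀ i < 3, d i ∈ W → ((range 3).image d ∩ W).Nonempty := fun i hi h =>
            ⟨d i, mem_inter.2 ⟨mem_image_of_mem d (mem_range.2 hi), h⟩⟩
          rcases hW _ h0 _ h1 _ h2 h01 h12 h02 hne with h | h | h
          · exact hi 0 (by norm_num) h
          · exact hi 1 (by norm_num) h
          · exact hi 2 (by norm_num) h
        have := hcard W hW
        omega
      · rcases Nat.lt_succ_iff_lt_or_eq.1 ht' with hlt | rfl
        · obtain ⟨i, hi, h⟩ := hhit t' hlt hp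
          exact ⟨i, hi, mem_union_left _ h⟩
        · exact ⟨0, by norm_num, mem_union_right _ (mem_image_of_mem d (mem_range.2 (by norm_num)))⟩
    · rw [if_neg hc]
      refine ⟨U, hU, rfl, hcard, fun t' ht' hp => ?_⟩
      rcases Nat.lt_succ_iff_lt_or_eq.1 ht' with hlt | rfl
      · exact hhit t' hlt hp
      · by_contra hcon
        push Not at hcon
        exact hc ⟨hp, hcon⟩

theorem mod_spec :
    (∀ u, Mod x.encode u → u < x.n) ∧
    (∀ W, HitsPaths x.n (Adj x.encode) W → modSize x.encode ≤ 3 * W.card) ∧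
    ∀ a < x.n, ∀ b < x.n, ∀ c < x.n, ¬ Mod x.encode a → ¬ Mod x.encode b → ¬ Mod x.encode c →
      Adj x.encode a b → Adj x.encode b c → a ≠ c → Adj x.encode a c := by
  obtain ⟨U, hU, hmask, hcard, hhit⟩ := exists_greedy x (x.n ^ 3) le_rfl
  have hm : mask x.encode = ∑ u ∈ U, 2 ^ u := by
    rw [mask, order_encode, ← hmask, show x.n * x.n * x.n = x.n ^ 3 by ring]
  have hMod : ∀ v, Mod x.encode v ↔ v ∈ U := by
    intro v
    rw [Mod, order_encode, hm]
    constructor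
    · rintro ⟨hv, h⟩
      rw [digit_mask x hU hv] at h
      by_contra hvU
      rw [if_neg hvU] at h
      omega
    · intro hv
      have hvn := mem_range.1 (hU hv)
      exact ⟨hvn, by rw [digit_mask x hU hvn, if_pos hv]⟩
  refine ⟨fun u hu => mem_range.1 (hU ((hMod u).1 hu)), fun W hW => ?_, ?_⟩
  · have : (range (order x.encode)).filter (Mod x.encode) = U := by
      ext v
      rw [mem_filter, hMod, order_encode]
      exact ⟨fun h => h.2, fun h => ⟨hU h, h⟩⟩
    rw [modSize, this]
    exact (hcard W hW).trans (Nat.mul_le_mul_left _ (card_le_card inter_subset_right))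
  · intro a ha b hb c hc hMa hMb hMc hab hbc hne
    rw [hMod] at hMa hMb hMc
    by_contra hac
    let f : ℕ → ℕ := fun i => if i = 0 then a else if i = 1 then b else c
    obtain ⟨t, ht, hf⟩ := exists_digits_eq (b := x.n) (l := 3) (f := f) (fun i _ => by
      simp only [f]; split_ifs <;> assumption)
    have hdig : ∀ i < 3, digitW x.encode (order x.encode) t i = f i := fun i hi => by
      rw [digit_triple x ht hi, hf i hi]
    have e0 : digitW x.encode (order x.encode) t 0 = a := hdig 0 (by norm_num)
    have e1 : digitW x.encode (order x.encode) t 1 = b := hdig 1 (by norm_num)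
    have e2 : digitW x.encode (order x.encode) t 2 = c := hdig 2 (by norm_num)
    have hp : IsPath x.encode t := by
      rw [IsPath, e0, e1, e2]
      exact ⟨hab, hbc, hac, hne⟩
    obtain ⟨i, hi, h⟩ := hhit t ht hp
    interval_cases i
    · exact hMa (e0 ▸ h)
    · exact hMb (e1 ▸ h)
    · exact hMc (e2 ▸ h)

theorem modSize_le_order : modSize x.encode ≤ x.n := by
  rw [modSize, order_encode]
  exact (card_filter_le _ _).trans (card_range _).le

theorem exists_isCluster_card_eq_distToCluster :
    ∃ W : Finset (Fin x.n), W.card = x.G.distToCluster ∧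
      (x.G.induce ((W : Set (Fin x.n))ᶜ)).IsCluster := by
  refine Nat.sInf_mem
    (s := {d | ∃ W : Finset (Fin x.n), W.card = d ∧ (x.G.induce ((W : Set (Fin x.n))ᶜ)).IsCluster})
    ⟨_, univ, rfl, fun C => ?_⟩
  induction C using SimpleGraph.ConnectedComponent.ind with
  | h v => exact absurd (mem_coe.2 (mem_univ v.1)) v.2

theorem modSize_le : modSize x.encode ≤ 3 * x.G.distToCluster := by
  obtain ⟨W, hW, hcl⟩ := exists_isCluster_card_eq_distToCluster x
  rw [← hW, ← card_map Fin.valEmbedding]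
  refine (mod_spec x).2.1 _ ?_
  intro a ha b hb c hc hab hbc hac hne
  by_contra hcon
  push Not at hcon
  rw [adj_encode x ha hb] at hab
  rw [adj_encode x hb hc] at hbc
  rw [adj_encode x ha hc] at hac
  have hmem : ∀ v (hv : v < x.n), v ∉ W.map Fin.valEmbedding →
      (⟨v, hv⟩ : Fin x.n) ∈ ((W : Set (Fin x.n))ᶜ) := fun v hv h h' =>
    h (mem_map.2 ⟨⟨v, hv⟩, h', rfl⟩)
  let H := x.G.induce ((W : Set (Fin x.n))ᶜ)
  let a' : ((W : Set (Fin x.n))ᶜ : Set (Fin x.n)) := ⟨⟨a, ha⟩, hmem a ha hcon.1⟩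
  let b' : ((W : Set (Fin x.n))ᶜ : Set (Fin x.n)) := ⟨⟨b, hb⟩, hmem b hb hcon.2.1⟩
  let c' : ((W : Set (Fin x.n))ᶜ : Set (Fin x.n)) := ⟨⟨c, hc⟩, hmem c hc hcon.2.2⟩
  have hab' : H.Adj a' b' := hab
  have hbc' : H.Adj b' c' := hbc
  have hr : H.Reachable a' c' := hab'.reachable.trans hbc'.reachable
  have hclq := hcl (H.connectedComponentMk c')
  have : H.Adj a' c' := hclq (SimpleGraph.ConnectedComponent.sound hr)
    (SimpleGraph.ConnectedComponent.sound (SimpleGraph.Reachable.refl c')) (fun h => hne (by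
      have := congrArg (fun z => (z.1 : Fin x.n).1) h
      exact this))
  exact hac this

end EqColAlg

namespace EqColAlg

open Finset RAM CliqueColoring

open scoped Classical

variable (x : EqColInstance)

/-! The Hall condition. -/

theorem colorCodes_encode : colorCodes x.encode = modSize x.encode ^ modSize x.encode := by
  rw [colorCodes, powW, min_eq_left ((modSize_le_order x).trans (le_width x))]

theorem setCodes_encode : setCodes x.encode = 2 ^ modSize x.encode :=
  powW_two x ((modSize_le_order x).trans (le_width x))

theorem mem_codeSet_iff {s j c : ℕ} (hs : s < 2 ^ modSize x.encode) :
    c ∈ codeSet (palette x.encode) (modSize x.encode) s j ↔ InSet x.encode s j c := by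
  rw [codeSet, mem_filter, mem_range, InSet]
  refine and_congr_right fun _ => or_congr_left (and_congr_right fun hc => ?_)
  have h1 := modSize_le_order x
  have h2 := le_width x
  have h3 := three_le_width x
  rw [digitW_eq (by norm_num) (by omega) (by omega)
    (hs.trans_le (Nat.pow_le_pow_right (by norm_num) (by omega)))]

theorem filter_inSet_eq {s : ℕ} (hs : s < 2 ^ modSize x.encode) (j : ℕ) :
    (range (palette x.encode)).filter (InSet x.encode s j) =
      codeSet (palette x.encode) (modSize x.encode) s j := by
  ext c
  rw [mem_codeSet_iff x hs, mem_filter, mem_range]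
  exact ⟨fun h => h.2, fun h => ⟨h.1, h⟩⟩

theorem isModulator_encode :
    IsModulator (padOrder x.encode) (PadAdj x.encode) (Mod x.encode) := by
  have := isModulator_padded (N := padOrder x.encode) (adj_symm x) (adj_irrefl x) (mod_spec x).2.2
  rw [← order_encode x] at this
  exact this

theorem excess_eq {y a t : ℕ} (i : ℕ) (ht : t < 2 ^ modSize x.encode) (ha : a < padOrder x.encode)
    (hr : Rep x.encode a) :
    excess x.encode y a t i =
      (codeSet (palette x.encode) (modSize x.encode) t i).card -
        (nbr (rest (padOrder x.encode) (Mod x.encode))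
          (rep (padOrder x.encode) (PadAdj x.encode) (Mod x.encode))
          (IsFree (order x.encode) (PadAdj x.encode) (Mod x.encode) (color x.encode y)) a
          (codeSet (palette x.encode) (modSize x.encode) t i)).card := by
  rw [excess, filter_inSet_eq x ht]
  refine congrArg (HSub.hSub _) (congrArg Finset.card ?_)
  ext v
  rw [nbr, mem_filter, mem_filter, rest, mem_filter, mem_range, InClique]
  simp only [mem_codeSet_iff x ht]
  constructor
  · rintro ⟨hv, ⟨hM, hav⟩, c, -, hc, hf⟩
    exact ⟨⟨hv, hM⟩, ((isModulator_encode x).rep_eq_iff ha hr hv hM).2 hav, c, hc, hf⟩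
  · rintro ⟨⟨hv, hM⟩, hav, c, hc, hf⟩
    exact ⟨hv, ⟨hM, ((isModulator_encode x).rep_eq_iff ha hr hv hM).1 hav⟩, c, hc.1, hc, hf⟩

theorem defect_eq {y s j a : ℕ} (hs : s < 2 ^ modSize x.encode) (ha : a < padOrder x.encode)
    (hr : Rep x.encode a) :
    defect x.encode y s j a =
      codeDeficiency (rest (padOrder x.encode) (Mod x.encode))
        (rep (padOrder x.encode) (PadAdj x.encode) (Mod x.encode)) (palette x.encode)
        (modSize x.encode)
        (IsFree (order x.encode) (PadAdj x.encode) (Mod x.encode) (color x.encode y))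
        (codeSet (palette x.encode) (modSize x.encode) s j) a := by
  rw [defect, codeDeficiency, setCodes_encode]
  refine sup_congr rfl fun t ht => sup_congr rfl fun i _ => ?_
  rw [mem_range] at ht
  rw [excess_eq x i ht ha hr]
  refine if_congr ?_ rfl rfl
  constructor
  · intro h c hc
    rw [mem_codeSet_iff x ht] at hc
    rw [mem_codeSet_iff x hs]
    exact h c hc.1 hc
  · intro h c _ hc
    rw [← mem_codeSet_iff x hs]
    exact h ((mem_codeSet_iff x ht).2 hc)

theorem extends_iff (y : ℕ) (hle : x.n ≤ padOrder x.encode)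
    (hlt : ∀ u, Mod x.encode u → color x.encode y u < palette x.encode)
    (hlt' : ∀ u, Mod x.encode u → color x.encode y u < modSize x.encode)
    (hproper : ∀ u v, Mod x.encode u → Mod x.encode v → Adj x.encode u v →
      color x.encode y u ≠ color x.encode y v) :
    Extends x.encode y ↔
      ∃ ψ, IsExactColoring (padOrder x.encode) (palette x.encode) (classSize x.encode)
        (PadAdj x.encode) ψ ∧ ∀ u, Mod x.encode u → ψ u = color x.encode y u := by
  have hMn : ∀ u, Mod x.encode u → u < order x.encode := fun u hu => hu.1
  rw [exists_extension_iff (isModulator_encode x) hMn (by rwa [order_encode]) rfl hlt hlt']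
  · rw [Extends, setCodes_encode]
    refine and_congr Iff.rfl (forall₂_congr fun s hs => forall₂_congr fun j _ => ?_)
    have h1 : (∑ a ∈ range (padOrder x.encode),
        if Rep x.encode a then defect x.encode y s j a else 0) =
        ∑ a ∈ reps (padOrder x.encode) (PadAdj x.encode) (Mod x.encode),
          codeDeficiency (rest (padOrder x.encode) (Mod x.encode))
            (rep (padOrder x.encode) (PadAdj x.encode) (Mod x.encode)) (palette x.encode)
            (modSize x.encode)
            (IsFree (order x.encode) (PadAdj x.encode) (Mod x.encode) (color x.encode y))
            (codeSet (palette x.encode) (modSize x.encode) s j) a := by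
      rw [← sum_filter]
      refine sum_congr rfl fun a ha => ?_
      rw [reps, mem_filter, mem_range] at ha
      exact defect_eq x hs ha.1 ha.2
    have h2 : (∑ c ∈ range (palette x.encode),
        if InSet x.encode s j c then supply x.encode y c - classSize x.encode else 0) =
        ∑ c ∈ codeSet (palette x.encode) (modSize x.encode) s j,
          (supply x.encode y c - classSize x.encode) := by
      rw [← sum_filter, filter_inSet_eq x hs]
    rw [h1, h2]
    rfl
  · rintro u v hu hv (⟨_, _, h⟩ | ⟨h, _, _⟩)
    · exact hproper u v hu hv h
    · exact absurd (hMn u hu) (not_lt.2 h)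

theorem color_eq_decode {y u : ℕ} (hy : y < modSize x.encode ^ modSize x.encode)
    (hu : Mod x.encode u) :
    color x.encode y u = decode (order x.encode) (modSize x.encode) (Mod x.encode) y u := by
  have h1 := modSize_le_order x
  have h2 := le_width x
  have h4 : rank x.encode u < modSize x.encode := rankIn_lt_card hu.1 hu
  rw [color, digitW_eq (by omega) (by omega) (by omega)]
  · rfl
  · calc y < modSize x.encode ^ modSize x.encode := hy
      _ ≤ (2 ^ x.n) ^ x.n := (Nat.pow_le_pow_left (h1.trans Nat.lt_two_pow_self.le) _).trans
          (Nat.pow_le_pow_right (by positivity) h1)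
      _ = 2 ^ (x.n * x.n) := by rw [← pow_mul]
      _ ≤ _ := Nat.pow_le_pow_right (by norm_num) (mul_self_le_width x)

theorem classSize_encode (hk : 0 < x.k) (hkn : x.k < x.n) : classSize x.encode = x.n ⌈/⌉ x.k := by
  have hp : palette x.encode = x.k := by
    rw [palette, colors_encode, order_encode, min_eq_left hkn.le]
  have h1 : x.n ⌈/⌉ x.k ≤ x.n := by
    rw [ceilDiv_le_iff_le_smul hk, smul_eq_mul]
    exact Nat.le_mul_of_pos_left _ hk
  have h2 : ∀ i, x.k * i < x.n ↔ i < x.n ⌈/⌉ x.k := fun i => by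
    rw [← not_le, ← not_le, ceilDiv_le_iff_le_smul hk, smul_eq_mul]
  have h3 : ((range x.n).filter fun i => x.k * i < x.n) = range (x.n ⌈/⌉ x.k) := by
    ext i
    rw [mem_filter, mem_range, mem_range, h2]
    omega
  rw [classSize, hp, order_encode, h3, card_range]

theorem exists_isEquitable_iff_codes (hk : 0 < x.k) (hkn : x.k < x.n) :
    (∃ φ, IsEquitable x.n x.k (Adj x.encode) φ) ↔
      ∃ y < colorCodes x.encode, Proper x.encode y ∧ Extends x.encode y := by
  have hp : palette x.encode = x.k := by
    rw [palette, colors_encode, order_encode, min_eq_left hkn.le]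
  have hpad : padOrder x.encode = x.k * (x.n ⌈/⌉ x.k) := by
    rw [padOrder, hp, classSize_encode x hk hkn]
  have hMn : ∀ u, Mod x.encode u → u < order x.encode := fun u hu => hu.1
  have hE : padded (order x.encode) (Adj x.encode) = PadAdj x.encode := rfl
  rw [← order_encode x, exists_isEquitable_iff (r := modSize x.encode) hk hMn rfl, hE,
    order_encode, ← hpad, ← classSize_encode x hk hkn, ← hp, ← order_encode x, colorCodes_encode]
  refine exists_congr fun y => and_congr_right fun hy => ?_
  have hcol : ∀ u, Mod x.encode u →
      decode (order x.encode) (modSize x.encode) (Mod x.encode) y u = color x.encode y u :=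
    fun u hu => (color_eq_decode x hy hu).symm
  have h1 : (∀ u, Mod x.encode u →
      decode (order x.encode) (modSize x.encode) (Mod x.encode) y u < palette x.encode ∧
      ∀ v, Mod x.encode v → Adj x.encode u v →
        decode (order x.encode) (modSize x.encode) (Mod x.encode) y u ≠
          decode (order x.encode) (modSize x.encode) (Mod x.encode) y v) ↔
      Proper x.encode y := by
    constructor
    · intro h u _ hu
      obtain ⟨h2, h3⟩ := h u hu
      rw [hcol u hu] at h2 h3
      refine ⟨h2, fun v _ hv hA => ?_⟩
      rw [← hcol v hv]
      exact h3 v hv hA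
    · intro h u hu
      obtain ⟨h2, h3⟩ := h u hu.1 hu
      rw [hcol u hu]
      refine ⟨h2, fun v hv hA => ?_⟩
      rw [hcol v hv]
      exact h3 v hv.1 hv hA
  rw [h1]
  refine and_congr_right fun hprop => ?_
  rw [extends_iff x y]
  · refine exists_congr fun ψ => and_congr_right fun _ => forall₂_congr fun u hu => ?_
    rw [hcol u hu]
  · rw [hpad]; exact le_mul_ceilDiv hk
  · exact fun u hu => (hprop u hu.1 hu).1
  · intro u hu
    have h4 : rank x.encode u < modSize x.encode := rankIn_lt_card hu.1 hu
    rw [← hcol u hu]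
    exact Nat.mod_lt _ (by omega)
  · exact fun u v hu hv hA => (hprop u hu.1 hu).2 v hv.1 hv hA

/-! Graphs on `Fin n`. -/

theorem ncard_fiber {n : ℕ} {φ : Fin n → ℕ} {φ' : ℕ → ℕ} (h : ∀ v : Fin n, φ' v = φ v) (c : ℕ) :
    {v : Fin n | φ v = c}.ncard = ((range n).filter fun v => φ' v = c).card := by
  rw [← Set.ncard_coe_finset, ← Set.ncard_image_of_injective _ Fin.val_injective]
  congr 1
  ext v
  simp only [Set.mem_image, Set.mem_ofPred_eq, coe_filter, mem_range]
  constructor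
  · rintro ⟨u, hu, rfl⟩
    exact ⟨u.2, (h u).trans hu⟩
  · rintro ⟨hv, hc⟩
    exact ⟨⟨v, hv⟩, (h ⟨v, hv⟩).symm.trans hc, rfl⟩

theorem equitablyColorable_iff :
    x.G.EquitablyColorable x.k ↔ ∃ φ, IsEquitable x.n x.k (Adj x.encode) φ := by
  constructor
  · rintro ⟨φ, hφ⟩
    let φ' : ℕ → ℕ := fun v => if h : v < x.n then (φ ⟨v, h⟩ : ℕ) else 0
    have hφ' : ∀ v : Fin x.n, φ' v = φ v := fun v => dif_pos v.2
    have hcard : ∀ c (hc : c < x.k), {v | φ v = ⟨c, hc⟩}.ncard =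
        ((range x.n).filter fun v => φ' v = c).card := by
      intro c hc
      rw [← ncard_fiber (φ := fun v => (φ v : ℕ)) hφ']
      congr 1
      ext v
      simp [Fin.ext_iff]
    refine ⟨φ', fun v hv => ?_, fun u hu v hv hA => ?_, fun c hc => ?_, fun c hc => ?_⟩
    · rw [hφ' ⟨v, hv⟩]; exact (φ _).2
    · rw [adj_encode x hu hv] at hA
      rw [hφ' ⟨u, hu⟩, hφ' ⟨v, hv⟩]
      exact fun h => φ.valid hA (Fin.ext h)
    · have := (hφ ⟨c, hc⟩).1
      rwa [hcard, Fintype.card_fin] at this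
    · have := (hφ ⟨c, hc⟩).2
      rwa [hcard, Fintype.card_fin] at this
  · rintro ⟨φ, hφ⟩
    refine ⟨SimpleGraph.Coloring.mk (fun v => (⟨φ v, hφ.lt v v.2⟩ : Fin x.k)) ?_, fun c => ?_⟩
    · intro u v hA h
      exact hφ.proper u u.2 v v.2 ((adj_encode x u.2 v.2).2 hA) (congrArg Fin.val h)
    · have : {v : Fin x.n | SimpleGraph.Coloring.mk (G := x.G)
          (fun v => (⟨φ v, hφ.lt v v.2⟩ : Fin x.k)) (by
            intro u v hA h
            exact hφ.proper u u.2 v v.2 ((adj_encode x u.2 v.2).2 hA) (congrArg Fin.val h)) v =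
            c} = {v : Fin x.n | φ v = c} := by
        ext v
        exact Fin.ext_iff
      rw [this, ncard_fiber (φ := fun v : Fin x.n => φ v) (fun _ => rfl), Fintype.card_fin]
      exact ⟨hφ.le_card c c.2, hφ.card_le c c.2⟩

theorem exists_isEquitable_of_le {n k : ℕ} {A : ℕ → ℕ → Prop} (hirr : ∀ u < n, ¬ A u u)
    (h : n ≤ k) : ∃ φ, IsEquitable n k A φ := by
  have hcard : ∀ c, ((range n).filter fun v => id v = c).card = if c < n then 1 else 0 := by
    intro c
    have := Finset.filter_eq' (range n) c
    simp only [id]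
    rw [this]
    by_cases hc : c < n
    · rw [if_pos (mem_range.2 hc), if_pos hc, card_singleton]
    · rw [if_neg (by rwa [mem_range]), if_neg hc, card_empty]
  refine ⟨id, fun v hv => lt_of_lt_of_le hv h, fun u hu v _ hA he => ?_, fun c hc => ?_,
    fun c hc => ?_⟩
  · exact hirr u hu (by have : u = v := he; rwa [← this] at hA)
  · rw [hcard]
    have hk : 0 < k := by omega
    split_ifs with hcn
    · exact (Nat.div_le_div_right h).trans (Nat.div_self hk).le
    · exact (Nat.div_eq_of_lt (by omega)).le
  · rw [hcard]
    split_ifs with hcn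
    · have h1 := le_mul_ceilDiv (n := n) (k := k) (by omega)
      by_contra h0
      rw [Nat.lt_one_iff.1 (not_le.1 h0), mul_zero] at h1
      omega
    · exact Nat.zero_le _

/-- The algorithm is correct. -/
theorem accepts_iff : Accepts x.encode ↔ x.G.EquitablyColorable x.k := by
  rw [equitablyColorable_iff, Accepts, order_encode, colors_encode]
  by_cases hkn : x.n ≤ x.k
  · exact ⟨fun _ => exists_isEquitable_of_le (adj_irrefl x) hkn, fun _ => .inl hkn⟩
  · rcases Nat.eq_zero_or_pos x.k with hk | hk
    · refine ⟨fun h => ?_, fun ⟨φ, hφ⟩ => ?_⟩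
      · rcases h with h | h
        · exact absurd h hkn
        · omega
      · have := hφ.lt 0 (by omega)
        omega
    · rw [exists_isEquitable_iff_codes x hk (not_le.1 hkn)]
      exact ⟨fun h => (h.resolve_left hkn).2, fun h => .inr ⟨hk, h⟩⟩

/-! ### The running time -/

theorem pow_self_add_two_pow_le {r d : ℕ} (h : r ≤ 3 * d) :
    1 + r ^ r + 2 ^ r ≤ 36 * d ^ (9 * d) := by
  have h1 : r ^ r ≤ (3 * d) ^ (3 * d) := by
    rcases Nat.eq_zero_or_pos d with rfl | hd
    · rw [Nat.le_zero.1 h]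
    · exact (Nat.pow_le_pow_left h r).trans (Nat.pow_le_pow_right (by omega) h)
  have h2 : 2 ^ r ≤ 2 ^ (3 * d) := Nat.pow_le_pow_right (by norm_num) h
  rcases Nat.lt_or_ge d 2 with hd | hd
  · interval_cases d
    · norm_num at h1 h2 ⊢; omega
    · norm_num at h1 h2 ⊢; omega
  · have h3 : (3 * d) ^ (3 * d) ≤ d ^ (9 * d) := by
      calc (3 * d) ^ (3 * d) ≤ (d ^ 3) ^ (3 * d) := Nat.pow_le_pow_left
            (by rw [pow_succ]; exact Nat.mul_le_mul_right _ (by nlinarith)) _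
        _ = d ^ (9 * d) := by rw [← pow_mul]; congr 1; ring
    have h4 : 2 ^ (3 * d) ≤ d ^ (9 * d) :=
      (Nat.pow_le_pow_left hd _).trans (Nat.pow_le_pow_right (by omega) (by omega))
    have h5 : 1 ≤ d ^ (9 * d) := Nat.one_le_pow _ _ (by omega)
    omega

theorem budget_le :
    budget x.encode + 1 ≤
      36 * x.G.distToCluster ^ (9 * x.G.distToCluster) * (x.encode.length + 1) := by
  have h := pow_self_add_two_pow_le (modSize_le x)
  rw [budget, colorCodes_encode, setCodes_encode]
  set X := modSize x.encode ^ modSize x.encode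
  set Y := 2 ^ modSize x.encode
  calc x.encode.length + X + Y + 1 ≤ (1 + X + Y) * (x.encode.length + 1) := by nlinarith
    _ ≤ _ := Nat.mul_le_mul_right _ h

theorem time_le (C D d L T : ℕ) (hT : T ≤ 36 * d ^ (9 * d) * (L + 1)) :
    C * T ^ D ≤ (C * 36 ^ D + 9 * D) * d ^ ((C * 36 ^ D + 9 * D) * d) * (L + 1) ^ D := by
  have h1 : d ^ (9 * D * d) ≤ d ^ ((C * 36 ^ D + 9 * D) * d) := by
    rcases Nat.eq_zero_or_pos d with rfl | hd
    · simp
    · exact Nat.pow_le_pow_right hd (Nat.mul_le_mul_right _ (by omega))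
  calc C * T ^ D ≤ C * (36 * d ^ (9 * d) * (L + 1)) ^ D := by gcongr
    _ = C * 36 ^ D * d ^ (9 * D * d) * (L + 1) ^ D := by
      rw [mul_pow, mul_pow, ← pow_mul, show 9 * d * D = 9 * D * d by ring]; ring
    _ ≤ _ := by gcongr; omega

theorem exists_solvableWith :
    ∃ a : ℕ, equitableColoringByDistToCluster.SolvableWith (fun d => a * d ^ (a * d)) := by
  obtain ⟨p, C, D, hp⟩ := exists_prog
  refine ⟨C * 36 ^ D + 9 * D, p, D, fun (x : EqColInstance) => ?_⟩
  obtain ⟨t, m', ht, hr, h⟩ := hp x.encode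
  rw [accepts_iff] at h
  exact ⟨t, m', ht.trans (time_le C D _ _ _ (budget_le x)), hr, h⟩

theorem computable_mul_pow (a : ℕ) : Computable fun d : ℕ => a * d ^ (a * d) := by
  have hpow : Primrec₂ fun d e : ℕ => d ^ e := by
    refine (Primrec.nat_rec (f := fun _ : ℕ => 1) (g := fun (d : ℕ) (p : ℕ × ℕ) => p.2 * d)
      (Primrec.const 1) ?_).of_eq fun d e => ?_
    · exact Primrec.nat_mul.comp (Primrec.snd.comp Primrec.snd) Primrec.fst
    · induction e with
      | zero => rfl
      | succ e ih => rw [pow_succ, ← ih]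
  exact (Primrec.nat_mul.comp (Primrec.const a) (hpow.comp Primrec.id
    (Primrec.nat_mul.comp (Primrec.const a) Primrec.id))).to_comp

end EqColAlg

theorem mainTheorem1 :
    equitableColoringByDistToCluster.IsFPT ∧
      ∃ a : ℕ, equitableColoringByDistToCluster.SolvableWith (fun d => a * d ^ (a * d)) := by
  obtain ⟨a, ha⟩ := EqColAlg.exists_solvableWith
  exact ⟨⟨_, EqColAlg.computable_mul_pow a, ha⟩, a, ha⟩
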